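/- **Proposition 1.5.** Let $\mathbb K$ be a field of characteristic $0$ and let $\Lambda$ be the graded Hopf algebra over $\mathbb K$ of symmetric functions in $x_1,x_2,\dots$ (graded by degree), with coproduct determined by $\Delta p_n = p_n\otimes 1+1\otimes p_n$ for the power sums $p_n$, and with counit the constant term. For a partition $\lambda$ let $\widetilde m_\lambda = \big(\prod_{i\ge1} r_i(\lambda)!\big)\, m_\lambda$, where $m_\lambda$ is the monomial symmetric function and $r_i(\lambda)$ is the number of parts of $\lambda$ equal to $i$. Let $\widetilde\Lambda$ be the Hopf algebra with the same underlying vector space, grading, coproduct and counit as $\Lambda$, but with the product $\odot$ given by $\widetilde m_\lambda\odot\widetilde m_\mu=\widetilde m_{\lambda\sqcup\mu}$, where $\lambda\sqcup\mu$ consists of all parts of $\lambda$ together with all parts of $\mu$. A weighted graph $G$ is a finite simple graph with a positive integer weight $w(v)$ on each vertex $v$; its total weight is the sum of the weights of its vertices. Its complement $\overline G$ and its induced subgraphs keep the vertex weights, and isomorphisms of weighted graphs preserve them. Its chromatic symmetric function is $X_G=\sum_\kappa\prod_{v} x_{\kappa(v)}^{w(v)}$, where $\kappa$ ranges over the proper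 colorings of $G$ by positive integers. Let $G_1,G_2,\dots$ be connected weighted graphs such that $G_n$ has total weight $n$ and every (nonempty) connected induced subgraph of each $G_n$ is isomorphic to some $G_i$. For a partition $\lambda=\lambda_1\dots\lambda_\ell$ let $G_\lambda=G_{\lambda_1}\sqcup\dots\sqcup G_{\lambda_\ell}$ be the disjoint union. Then there is exactly one linear map $\varphi:\Lambda\to\widetilde\Lambda$ with $\varphi(X_{G_\lambda})=X_{\overline{G_\lambda}}$ for all partitions $\lambda$, and $\varphi$ is a morphism of graded Hopf algebras: it preserves product, unit, coproduct, counit and degree. If $\varphi$ is an isomorphism, then every $G_n$ is a clique (any two distinct vertices are adjacent). -/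

import Mathlib

open scoped TensorProduct

universe u v

set_option linter.unusedSectionVars false

namespace SymF

/-- The multiset of nonzero exponents of the monomial `x^d`. Partitions are represented throughout
as multisets of positive integers, the multiset of their parts. -/
noncomputable def expType {σ : Type*} (d : σ →₀ ℕ) : Multiset ℕ+ :=
  d.sum fun _ n => if h : 0 < n then {⟨n, h⟩} else 0

theorem expType_zero {σ : Type*} : expType (0 : σ →₀ ℕ) = 0 := by simp [expType]

theorem expType_single {σ : Type*} (i : σ) (n : ℕ+) :
    expType (Finsupp.single i (n : ℕ)) = {n} := by
  simp [expType, Finsupp.sum_single_index]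
  rfl

theorem expType_mapDomain {σ τ : Type*} {f : σ → τ} (hf : Function.Injective f) (d : σ →₀ ℕ) :
    expType (d.mapDomain f) = expType d := by
  simp [expType, Finsupp.sum_mapDomain_index_inj hf]

theorem expType_add {σ : Type*} {d e : σ →₀ ℕ} (h : Disjoint d.support e.support) :
    expType (d + e) = expType d + expType e := by
  classical
  exact Finsupp.sum_add_index_of_disjoint h _

theorem expType_map {σ : Type*} (d : σ →₀ ℕ) :
    (expType d).map (fun n : ℕ+ => (n : ℕ)) = d.support.val.map d := by
  have h1 : expType d = ∑ i ∈ d.support, if h : 0 < d i then {⟨d i, h⟩} else 0 := rfl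
  rw [h1, ← Multiset.coe_mapAddMonoidHom, map_sum]
  have h2 : ∀ i ∈ d.support, (Multiset.mapAddMonoidHom (fun n : ℕ+ => (n : ℕ)))
      (if h : 0 < d i then {⟨d i, h⟩} else 0) = {d i} := by
    intro i hi
    have : 0 < d i := Nat.pos_of_ne_zero (Finsupp.mem_support_iff.mp hi)
    simp only [this, dite_true]
    exact Multiset.map_singleton _ _
  rw [Finset.sum_congr rfl h2]
  rw [Finset.sum, ← Multiset.sum_map_singleton (d.support.val.map d), Multiset.map_map]
  rfl

theorem card_expType {σ : Type*} (d : σ →₀ ℕ) :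
    Multiset.card (expType d) = d.support.card := by
  have := congrArg Multiset.card (expType_map d)
  simpa using this

theorem sum_expType {σ : Type*} (d : σ →₀ ℕ) :
    ((expType d).map (fun n : ℕ+ => (n : ℕ))).sum = d.degree := by
  rw [expType_map]; rfl

theorem exists_perm_of_map_eq {α β : Type*} [DecidableEq β] [Fintype α] (f g : α → β)
    (h : (Finset.univ : Finset α).val.map f = (Finset.univ : Finset α).val.map g) :
    ∃ s : Equiv.Perm α, ∀ a, g (s a) = f a := by
  have hc : ∀ b, Fintype.card {a // f a = b} = Fintype.card {a // g a = b} := by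
    intro b
    have := congrArg (Multiset.count b) h
    rw [Multiset.count_map, Multiset.count_map] at this
    rw [Fintype.card_subtype, Fintype.card_subtype, Finset.card_def, Finset.card_def,
      Finset.filter_val, Finset.filter_val]
    simpa [eq_comm] using this
  let e : ∀ b, {a // f a = b} ≃ {a // g a = b} := fun b => Fintype.equivOfCardEq (hc b)
  refine ⟨(Equiv.sigmaFiberEquiv f).symm.trans
    ((Equiv.sigmaCongrRight e).trans (Equiv.sigmaFiberEquiv g)), fun a => ?_⟩
  exact (e (f a) ⟨a, rfl⟩).2

theorem exists_perm {σ : Type*} {d e : σ →₀ ℕ} (h : expType d = expType e) :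
    ∃ s : Equiv.Perm σ, d.mapDomain s = e := by
  classical
  let U : Finset σ := d.support ∪ e.support
  have key : ∀ c : σ →₀ ℕ, c.support ⊆ U →
      (Finset.univ : Finset U).val.map (fun u : U => c u) =
        (expType c).map (fun n : ℕ+ => (n : ℕ)) +
          Multiset.replicate (U.card - Multiset.card (expType c)) 0 := by
    intro c hc
    have h1 : (Finset.univ : Finset U).val.map (fun u : U => c u) = U.val.map c := by
      have : (Finset.univ : Finset U).val.map (fun u : U => (u : σ)) = U.val := by
        change (U.attach.val.map Subtype.val) = U.val
        exact Multiset.attach_map_val _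
      rw [← this, Multiset.map_map]; rfl
    rw [h1, expType_map, card_expType, ← Finset.card_sdiff_of_subset hc]
    have h2 : U.val = c.support.val + (U \ c.support).val := by
      rw [Finset.sdiff_val, add_tsub_cancel_of_le]
      exact Finset.val_le_iff.mpr hc
    conv_lhs => rw [h2, Multiset.map_add]
    congr 1
    refine Multiset.eq_replicate.mpr ⟨by rw [Multiset.card_map]; rfl, ?_⟩
    intro b hb
    obtain ⟨a, ha, rfl⟩ := Multiset.mem_map.mp hb
    have := (Finset.mem_sdiff.mp (Finset.mem_def.mpr ha)).2
    simpa using this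
  have hk : (Finset.univ : Finset U).val.map (fun u : U => d u) =
      (Finset.univ : Finset U).val.map (fun u : U => e u) := by
    rw [key d Finset.subset_union_left, key e Finset.subset_union_right, h]
  obtain ⟨s, hs⟩ := exists_perm_of_map_eq _ _ hk
  refine ⟨Equiv.Perm.ofSubtype s, ?_⟩
  ext i
  obtain ⟨j, rfl⟩ := (Equiv.Perm.ofSubtype s).surjective i
  rw [Finsupp.mapDomain_apply (Equiv.injective _)]
  by_cases hj : j ∈ U
  · rw [Equiv.Perm.ofSubtype_apply_of_mem s hj]
    exact (hs ⟨j, hj⟩).symm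
  · rw [Equiv.Perm.ofSubtype_apply_of_not_mem s hj]
    simp only [U, Finset.mem_union, Finsupp.mem_support_iff, not_or, not_not] at hj
    rw [hj.1, hj.2]

theorem exists_expType (l : Multiset ℕ+) : ∃ d : ℕ →₀ ℕ, expType d = l := by
  classical
  induction l using Multiset.induction with
  | empty => exact ⟨0, expType_zero⟩
  | cons a l ih =>
    obtain ⟨d, rfl⟩ := ih
    obtain ⟨i, hi⟩ := Infinite.exists_notMem_finset d.support
    refine ⟨Finsupp.single i (a : ℕ) + d, ?_⟩
    rw [expType_add, expType_single, Multiset.singleton_add]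
    rw [Finsupp.support_single _ a.ne_zero]
    simpa using hi

/-- The ring `Λ` of symmetric functions: power series in countably many variables that are
invariant under permutations of the variables and of bounded degree. -/
def Lambda (K : Type*) [Field K] : Subalgebra K (MvPowerSeries ℕ K) where
  carrier := {f | (∀ (s : Equiv.Perm ℕ) (d : ℕ →₀ ℕ),
      MvPowerSeries.coeff (d.mapDomain s) f = MvPowerSeries.coeff d f) ∧
    ∃ N : ℕ, ∀ d : ℕ →₀ ℕ, N < d.degree → MvPowerSeries.coeff d f = 0}
  mul_mem' := by
    classical
    rintro f g ⟨hf, M, hM⟩ ⟨hg, N, hN⟩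
    refine ⟨fun s d => ?_, M + N, fun d hd => ?_⟩
    · rw [MvPowerSeries.coeff_mul, MvPowerSeries.coeff_mul]
      symm
      refine Finset.sum_bij' (fun p _ => (p.1.mapDomain s, p.2.mapDomain s))
        (fun p _ => (p.1.mapDomain s.symm, p.2.mapDomain s.symm)) ?_ ?_ ?_ ?_ ?_
      · intro p hp
        rw [Finset.HasAntidiagonal.mem_antidiagonal] at hp ⊢
        simp [← Finsupp.mapDomain_add, hp]
      · intro p hp
        rw [Finset.HasAntidiagonal.mem_antidiagonal] at hp ⊢
        simp [← Finsupp.mapDomain_add, hp, ← Finsupp.mapDomain_comp]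
      · intro p _
        simp [← Finsupp.mapDomain_comp]
      · intro p _
        simp [← Finsupp.mapDomain_comp]
      · intro p _
        simp only [hf, hg]
    · rw [MvPowerSeries.coeff_mul]
      refine Finset.sum_eq_zero fun p hp => ?_
      rw [Finset.HasAntidiagonal.mem_antidiagonal] at hp
      by_cases h : M < p.1.degree
      · rw [hM _ h, zero_mul]
      · have : N < p.2.degree := by
          have := congrArg Finsupp.degree hp
          rw [map_add] at this
          omega
        rw [hN _ this, mul_zero]
  add_mem' := by
    rintro f g ⟨hf, M, hM⟩ ⟨hg, N, hN⟩
    refine ⟨fun s d => ?_, max M N, fun d hd => ?_⟩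
    · rw [map_add, map_add, hf, hg]
    · rw [map_add, hM d (by omega), hN d (by omega), add_zero]
  algebraMap_mem' := by
    classical
    intro r
    refine ⟨fun s d => ?_, 0, fun d hd => ?_⟩
    · rw [MvPowerSeries.algebraMap_apply, MvPowerSeries.coeff_C, MvPowerSeries.coeff_C]
      have : d.mapDomain s = 0 ↔ d = 0 :=
        ⟨fun h => Finsupp.mapDomain_injective s.injective (by simpa using h),
          fun h => by simp [h]⟩
      simp [this]
    · rw [MvPowerSeries.algebraMap_apply, MvPowerSeries.coeff_C, if_neg]
      rintro rfl
      simp at hd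

section

variable {K : Type*} [Field K]

/-- The coefficient of a monomial, as a linear form on `Lambda K`. -/
noncomputable def co (d : ℕ →₀ ℕ) : Lambda K →ₗ[K] K :=
  (MvPowerSeries.coeff d).comp (Lambda K).val.toLinearMap

theorem co_apply (d : ℕ →₀ ℕ) (f : Lambda K) : co d f = MvPowerSeries.coeff d f.1 := rfl

theorem Lambda.ext_co {f g : Lambda K} (h : ∀ d, co d f = co d g) : f = g :=
  Subtype.ext (MvPowerSeries.ext h)

theorem co_eq_of_expType (f : Lambda K) {d e : ℕ →₀ ℕ} (h : expType d = expType e) :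
    co d f = co e f := by
  obtain ⟨s, rfl⟩ := exists_perm h
  exact (f.2.1 s d).symm

/-- A monomial whose nonzero exponents are the parts of `l`. -/
noncomputable def rep (l : Multiset ℕ+) : ℕ →₀ ℕ := (exists_expType l).choose

theorem expType_rep (l : Multiset ℕ+) : expType (rep l) = l := (exists_expType l).choose_spec

theorem co_rep (f : Lambda K) (d : ℕ →₀ ℕ) : co (rep (expType d)) f = co d f :=
  co_eq_of_expType f (expType_rep _)

theorem finite_parts (N : ℕ) :
    {l : Multiset ℕ+ | (l.map (fun n : ℕ+ => (n : ℕ))).sum ≤ N}.Finite := by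
  classical
  let B : Multiset ℕ+ :=
    N • (Finset.univ : Finset (Fin N)).val.map (fun i : Fin N => Nat.succPNat i)
  refine Set.Finite.subset (s := Set.Iic B) (Set.finite_Iic B) ?_
  intro l hl
  rw [Set.mem_Iic, Multiset.le_iff_count]
  intro a
  by_cases ha : a ∈ l
  · have hle : (a : ℕ) ≤ N :=
      (Multiset.single_le_sum (fun _ _ => Nat.zero_le _) _ (Multiset.mem_map_of_mem _ ha)).trans hl
    have hcard : Multiset.card l ≤ N := by
      refine le_trans ?_ hl
      have := Multiset.card_nsmul_le_sum (s := l.map (fun n : ℕ+ => (n : ℕ))) (a := 1) (by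
        intro x hx
        obtain ⟨n, _, rfl⟩ := Multiset.mem_map.mp hx
        exact n.2)
      rwa [Multiset.card_map, smul_eq_mul, mul_one] at this
    rw [Multiset.count_nsmul]
    refine (Multiset.count_le_card a l).trans (hcard.trans (Nat.le_mul_of_pos_right _ ?_))
    rw [Multiset.count_pos, Multiset.mem_map]
    refine ⟨⟨(a : ℕ) - 1, by have := a.pos; omega⟩, by simp, ?_⟩
    apply PNat.eq
    have := a.pos
    change (a : ℕ) - 1 + 1 = a
    omega
  · rw [Multiset.count_eq_zero_of_notMem ha]; exact Nat.zero_le _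

theorem sum_le_of_co {f : Lambda K} {N : ℕ}
    (hN : ∀ d : ℕ →₀ ℕ, N < d.degree → MvPowerSeries.coeff d f.1 = 0) {l : Multiset ℕ+}
    (h : co (rep l) f ≠ 0) : (l.map (fun n : ℕ+ => (n : ℕ))).sum ≤ N := by
  by_contra hlt
  apply h
  apply hN
  rw [← sum_expType, expType_rep]
  omega

/-- The symmetric function with prescribed coefficients on the monomials of each type. -/
noncomputable def ofCoeffs (c : Multiset ℕ+ →₀ K) : Lambda K :=
  ⟨fun d => c (expType d), by
    refine ⟨fun s d => congrArg c (expType_mapDomain s.injective d),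
      c.support.sup fun l => (l.map (fun n : ℕ+ => (n : ℕ))).sum, fun d hd => ?_⟩
    by_contra h
    have hm : expType d ∈ c.support := Finsupp.mem_support_iff.mpr h
    have := Finset.le_sup (f := fun l : Multiset ℕ+ => (l.map (fun n : ℕ+ => (n : ℕ))).sum) hm
    rw [sum_expType] at this
    omega⟩

theorem co_ofCoeffs (c : Multiset ℕ+ →₀ K) (d : ℕ →₀ ℕ) : co d (ofCoeffs c) = c (expType d) := rfl

/-- The basis of monomial symmetric functions `m_λ`: the coordinate of `f` at `λ` is the coefficient
in `f` of a monomial of type `λ`, see `co_mBasis`. -/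
noncomputable def mBasis (K : Type*) [Field K] : Module.Basis (Multiset ℕ+) K (Lambda K) :=
  .ofRepr
  { toFun := fun f => Finsupp.ofSupportFinite (fun l => co (rep l) f) (by
      obtain ⟨N, hN⟩ := f.2.2
      exact (finite_parts N).subset fun l hl => sum_le_of_co hN hl)
    invFun := ofCoeffs
    map_add' := fun f g => by ext l; exact map_add (co (rep l)) f g
    map_smul' := fun r f => by ext l; exact map_smul (co (rep l)) r f
    left_inv := fun f => Lambda.ext_co fun d => by
      rw [co_ofCoeffs]; exact co_rep f d
    right_inv := fun c => by
      ext l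
      change co (rep l) (ofCoeffs c) = c l
      rw [co_ofCoeffs, expType_rep] }

theorem mBasis_repr (f : Lambda K) (l : Multiset ℕ+) : (mBasis K).repr f l = co (rep l) f := rfl

theorem co_mBasis (l : Multiset ℕ+) (d : ℕ →₀ ℕ) :
    co d (mBasis K l) = if expType d = l then 1 else 0 := by
  rw [← co_rep, ← mBasis_repr, Module.Basis.repr_self, Finsupp.single_apply]
  simp [eq_comm]

/-- `∏ r_i(λ)!`, where `r_i(λ)` is the number of parts of `λ` equal to `i`. -/
def multFact (l : Multiset ℕ+) : ℕ := ∏ i ∈ l.toFinset, (l.count i).factorial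

/-- The basis of augmented monomial symmetric functions `m̃_λ = (∏ r_i(λ)!) m_λ`. -/
noncomputable def mtBasis (K : Type*) [Field K] [CharZero K] :
    Module.Basis (Multiset ℕ+) K (Lambda K) :=
  (mBasis K).isUnitSMul (w := fun l => (multFact l : K)) fun _ =>
    isUnit_iff_ne_zero.mpr (Nat.cast_ne_zero.mpr
      (Finset.prod_ne_zero_iff.mpr fun _ _ => Nat.factorial_ne_zero _))

theorem mtBasis_apply [CharZero K] (l : Multiset ℕ+) :
    mtBasis K l = (multFact l : K) • mBasis K l := Module.Basis.isUnitSMul_apply _ _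

theorem multFact_zero : multFact 0 = 1 := rfl

theorem multFact_cons (a : ℕ+) (l : Multiset ℕ+) :
    multFact (a ::ₘ l) = ((a ::ₘ l).count a) * multFact l := by
  have h1 : multFact l = ∏ i ∈ (a ::ₘ l).toFinset, (l.count i).factorial := by
    refine Finset.prod_subset ?_ ?_
    · intro x hx; simp at hx ⊢; exact Or.inr hx
    · intro x _ hx
      rw [Multiset.count_eq_zero_of_notMem (by simpa using hx)]; rfl
  have ha : a ∈ (a ::ₘ l).toFinset := by simp
  rw [h1, multFact, ← Finset.mul_prod_erase _ _ ha, ← Finset.mul_prod_erase _ _ ha, ← mul_assoc]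
  congr 1
  · rw [Multiset.count_cons_self, Nat.factorial_succ]
  · refine Finset.prod_congr rfl fun x hx => ?_
    rw [Multiset.count_cons_of_ne (Finset.ne_of_mem_erase hx)]

theorem co_mtBasis [CharZero K] (l : Multiset ℕ+) (d : ℕ →₀ ℕ) :
    co d (mtBasis K l) = if expType d = l then (multFact l : K) else 0 := by
  rw [mtBasis_apply, map_smul, co_mBasis]; split <;> simp

theorem mtBasis_zero [CharZero K] : mtBasis K 0 = 1 := by
  classical
  apply Lambda.ext_co
  intro d
  rw [co_mtBasis, multFact_zero, co_apply]
  change _ = MvPowerSeries.coeff d (1 : MvPowerSeries ℕ K)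
  rw [MvPowerSeries.coeff_one]
  have : expType d = 0 ↔ d = 0 := by
    rw [← Multiset.card_eq_zero, card_expType, Finset.card_eq_zero, Finsupp.support_eq_empty]
  simp [this]

end

section

variable {K : Type*} [Field K] [CharZero K]

/-- The vector space `Λ̃`, which is `Λ`; it carries a different product below. -/
def LambdaTilde (K : Type*) [Field K] : Type _ := Lambda K

noncomputable instance (K : Type*) [Field K] : AddCommGroup (LambdaTilde K) :=
  inferInstanceAs (AddCommGroup (Lambda K))

noncomputable instance (K : Type*) [Field K] : Module K (LambdaTilde K) :=
  inferInstanceAs (Module K (Lambda K))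

/-- The identity map `Λ → Λ̃`. -/
noncomputable def toTilde (K : Type*) [Field K] : Lambda K ≃ₗ[K] LambdaTilde K := LinearEquiv.refl K (Lambda K)

/-- The basis `m̃_λ` of `Λ̃`. -/
noncomputable def tBasis (K : Type*) [Field K] [CharZero K] :
    Module.Basis (Multiset ℕ+) K (LambdaTilde K) := (mtBasis K).map (toTilde K)

theorem tBasis_apply (l : Multiset ℕ+) : tBasis K l = toTilde K (mtBasis K l) :=
  Module.Basis.map_apply _ _ _

/-- The linear isomorphism of `Λ̃` with the monoid algebra of partitions under union of parts that
sends `m̃_λ` to `λ`. The product of `Λ̃` is transported along it, so that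
`m̃_λ ⊙ m̃_μ = m̃_{λ ⊔ μ}`, see `tBasis_add`. -/
noncomputable def tildeLin (K : Type*) [Field K] [CharZero K] :
    LambdaTilde K ≃ₗ[K] AddMonoidAlgebra K (Multiset ℕ+) :=
  (tBasis K).repr.trans (AddMonoidAlgebra.coeffLinearEquiv K).symm

noncomputable instance : Mul (LambdaTilde K) :=
  ⟨fun f g => (tildeLin K).symm (tildeLin K f * tildeLin K g)⟩
noncomputable instance : One (LambdaTilde K) := ⟨tBasis K 0⟩
noncomputable instance : NatCast (LambdaTilde K) := ⟨fun n => (tildeLin K).symm n⟩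
noncomputable instance : IntCast (LambdaTilde K) := ⟨fun n => (tildeLin K).symm n⟩
noncomputable instance : Pow (LambdaTilde K) ℕ :=
  ⟨fun f n => (tildeLin K).symm (tildeLin K f ^ n)⟩

theorem tildeLin_mul (f g : LambdaTilde K) :
    tildeLin K (f * g) = tildeLin K f * tildeLin K g :=
  (tildeLin K).apply_symm_apply _

theorem tildeLin_basis (l : Multiset ℕ+) :
    tildeLin K (tBasis K l) = AddMonoidAlgebra.single l 1 := by
  simp only [tildeLin, LinearEquiv.trans_apply, Module.Basis.repr_self]
  rfl

theorem tildeLin_one : tildeLin K 1 = 1 := tildeLin_basis 0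

noncomputable instance : CommRing (LambdaTilde K) :=
  Function.Injective.commRing (tildeLin K) (tildeLin K).injective (map_zero _) tildeLin_one
    (map_add _) tildeLin_mul (map_neg _) (map_sub _) (fun _ _ => map_nsmul _ _ _)
    (fun _ _ => map_zsmul _ _ _)
    (fun _ _ => (tildeLin K).apply_symm_apply _) (fun _ => (tildeLin K).apply_symm_apply _)
    (fun _ => (tildeLin K).apply_symm_apply _)

noncomputable instance : Algebra K (LambdaTilde K) :=
  Algebra.ofModule
    (fun r x y => (tildeLin K).injective (by
      simp only [tildeLin_mul, map_smul, smul_mul_assoc]))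
    (fun r x y => (tildeLin K).injective (by
      simp only [tildeLin_mul, map_smul, mul_smul_comm]))

theorem tBasis_zero : tBasis K 0 = 1 := rfl

theorem tBasis_add (l m : Multiset ℕ+) : tBasis K (l + m) = tBasis K l * tBasis K m :=
  (tildeLin K).injective (by
    rw [tildeLin_mul, tildeLin_basis, tildeLin_basis, tildeLin_basis,
      AddMonoidAlgebra.single_mul_single, one_mul])

theorem tBasis_eq_prod (l : Multiset ℕ+) :
    tBasis K l = (l.map fun n => tBasis K {n}).prod := by
  induction l using Multiset.induction with
  | empty => rfl
  | cons a l ih => rw [← Multiset.singleton_add, tBasis_add, ih]; simp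


/-- `tildeLin` as an isomorphism of algebras. -/
noncomputable def tildeAlg (K : Type*) [Field K] [CharZero K] :
    LambdaTilde K ≃ₐ[K] AddMonoidAlgebra K (Multiset ℕ+) :=
  AlgEquiv.ofLinearEquiv (tildeLin K) tildeLin_one tildeLin_mul

/-- The algebra morphism on `Λ̃` with prescribed values on the generators. -/
noncomputable def tildeLift {A : Type*} [CommRing A] [Algebra K A] (f : ℕ+ → A) :
    LambdaTilde K →ₐ[K] A :=
  (AddMonoidAlgebra.lift K A (Multiset ℕ+)
    { toFun := fun l => (l.toAdd.map f).prod
      map_one' := by rw [toAdd_one, Multiset.map_zero, Multiset.prod_zero]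
      map_mul' := fun x y => by rw [toAdd_mul, Multiset.map_add, Multiset.prod_add] }).comp (tildeAlg K).toAlgHom

theorem tildeLift_basis {A : Type*} [CommRing A] [Algebra K A] (f : ℕ+ → A) (l : Multiset ℕ+) :
    tildeLift (K := K) f (tBasis K l) = (l.map f).prod := by
  have h : tildeAlg K (tBasis K l) = AddMonoidAlgebra.single l 1 := tildeLin_basis l
  change AddMonoidAlgebra.lift K A (Multiset ℕ+) _ (tildeAlg K (tBasis K l)) = _
  rw [h, AddMonoidAlgebra.lift_single, one_smul]
  rfl

theorem tilde_adjoin :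
    Algebra.adjoin K (Set.range fun n : ℕ+ => tBasis K {n}) = ⊤ := by
  rw [eq_top_iff]
  intro x _
  have hx : x ∈ Submodule.span K (Set.range (tBasis K)) := by
    rw [(tBasis K).span_eq]; trivial
  refine (Submodule.span_le (p := Subalgebra.toSubmodule
    (Algebra.adjoin K (Set.range fun n : ℕ+ => tBasis K {n})))).mpr ?_ hx
  rintro _ ⟨l, rfl⟩
  rw [tBasis_eq_prod]
  refine Subalgebra.multiset_prod_mem _ ?_
  intro x hx
  obtain ⟨n, _, rfl⟩ := Multiset.mem_map.mp hx
  exact Algebra.subset_adjoin ⟨n, rfl⟩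

/-- The coproduct of `Λ`: `Δ m̃_λ = ∑ m̃_μ ⊗ m̃_ν`, the sum being over all ways of splitting the
parts of `λ` (equal parts being distinguished) into `μ` and `ν`. Equivalently `Δ f` is `f` evaluated
at the union of two sets of variables (`coco_coprod`), or `Δ` is the algebra morphism with
`Δ p_n = p_n ⊗ 1 + 1 ⊗ p_n` (`coprod_mul`, `coprod_psum`). -/
noncomputable def coprod (K : Type*) [Field K] [CharZero K] :
    Lambda K →ₗ[K] Lambda K ⊗[K] Lambda K :=
  (mtBasis K).constr K fun l =>
    (l.antidiagonal.map fun p => mtBasis K p.1 ⊗ₜ[K] mtBasis K p.2).sum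

theorem coprod_mt (l : Multiset ℕ+) : coprod K (mtBasis K l) =
    (l.antidiagonal.map fun p => mtBasis K p.1 ⊗ₜ[K] mtBasis K p.2).sum :=
  Module.Basis.constr_basis _ _ _ _

/-- The coproduct of `Λ̃` is that of `Λ`. -/
noncomputable def coprodTilde (K : Type*) [Field K] [CharZero K] :
    LambdaTilde K →ₗ[K] LambdaTilde K ⊗[K] LambdaTilde K :=
  (TensorProduct.map (toTilde K).toLinearMap (toTilde K).toLinearMap) ∘ₗ coprod K ∘ₗ
    (toTilde K).symm.toLinearMap

theorem coprodTilde_basis (l : Multiset ℕ+) : coprodTilde K (tBasis K l) =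
    (l.antidiagonal.map fun p => tBasis K p.1 ⊗ₜ[K] tBasis K p.2).sum := by
  have h : (toTilde K).symm (tBasis K l) = mtBasis K l := by
    rw [tBasis_apply, LinearEquiv.symm_apply_apply]
  simp only [coprodTilde, LinearMap.comp_apply, LinearEquiv.coe_coe, h, coprod_mt]
  rw [map_multiset_sum, Multiset.map_map]
  congr 1

/-- The coproduct of `Λ̃` as an algebra morphism. -/
noncomputable def coprodTildeAlg (K : Type*) [Field K] [CharZero K] :
    LambdaTilde K →ₐ[K] LambdaTilde K ⊗[K] LambdaTilde K :=
  tildeLift fun n => tBasis K {n} ⊗ₜ 1 + 1 ⊗ₜ tBasis K {n}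

theorem coprodTildeAlg_eq : (coprodTildeAlg K).toLinearMap = coprodTilde K := by
  refine (tBasis K).ext fun l => ?_
  rw [coprodTilde_basis, AlgHom.toLinearMap_apply, coprodTildeAlg, tildeLift_basis,
    Multiset.prod_map_add]
  congr 1
  refine Multiset.map_congr rfl fun p _ => ?_
  have h1 : ∀ s : Multiset ℕ+, (s.map fun n => tBasis K {n} ⊗ₜ[K] (1 : LambdaTilde K)).prod =
      tBasis K s ⊗ₜ 1 := by
    intro s
    induction s using Multiset.induction with
    | empty => rfl
    | cons a s ih =>
      rw [Multiset.map_cons, Multiset.prod_cons, ih, ← Multiset.singleton_add, tBasis_add,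
        Algebra.TensorProduct.tmul_mul_tmul, one_mul]
  have h2 : ∀ s : Multiset ℕ+, (s.map fun n => (1 : LambdaTilde K) ⊗ₜ[K] tBasis K {n}).prod =
      1 ⊗ₜ tBasis K s := by
    intro s
    induction s using Multiset.induction with
    | empty => rfl
    | cons a s ih =>
      rw [Multiset.map_cons, Multiset.prod_cons, ih, ← Multiset.singleton_add, tBasis_add,
        Algebra.TensorProduct.tmul_mul_tmul, one_mul]
  rw [h1, h2, Algebra.TensorProduct.tmul_mul_tmul, one_mul, mul_one]

/-- The counit: the constant term. -/
noncomputable def counitLin (K : Type*) [Field K] : Lambda K →ₗ[K] K := co 0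

/-- The counit of `Λ` as an algebra morphism. -/
noncomputable def counitAlg (K : Type*) [Field K] : Lambda K →ₐ[K] K :=
  AlgHom.ofLinearMap (counitLin K)
    (by
      change MvPowerSeries.coeff 0 (1 : MvPowerSeries ℕ K) = 1
      simp)
    (fun f g => by
      change MvPowerSeries.coeff 0 (f.1 * g.1) = MvPowerSeries.coeff 0 f.1 * MvPowerSeries.coeff 0 g.1
      simp)

/-- The counit of `Λ̃` is that of `Λ`. -/
noncomputable def counitTilde (K : Type*) [Field K] : LambdaTilde K →ₗ[K] K :=
  counitLin K ∘ₗ (toTilde K).symm.toLinearMap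

/-- The counit of `Λ̃` as an algebra morphism. -/
noncomputable def counitTildeAlg (K : Type*) [Field K] [CharZero K] :
    LambdaTilde K →ₐ[K] K := tildeLift fun _ => 0

theorem counitLin_mt (l : Multiset ℕ+) :
    counitLin K (mtBasis K l) = if l = 0 then 1 else 0 := by
  rw [counitLin, co_mtBasis, expType_zero]
  by_cases h : l = 0
  · simp [h, multFact_zero]
  · rw [if_neg h, if_neg (Ne.symm h)]

theorem counitTildeAlg_eq : (counitTildeAlg K).toLinearMap = counitTilde K := by
  refine (tBasis K).ext fun l => ?_
  rw [AlgHom.toLinearMap_apply, counitTildeAlg, tildeLift_basis, tBasis_apply]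
  simp only [counitTilde, LinearMap.comp_apply, LinearEquiv.coe_coe, LinearEquiv.symm_apply_apply,
    counitLin_mt]
  induction l using Multiset.induction with
  | empty => simp
  | cons a s ih => simp


/-- A commutative algebra generated by primitive elements is a bialgebra. -/
noncomputable abbrev bialgebraOfPrimitive {ι A : Type*} [CommRing A] [Algebra K A] (g : ι → A)
    (hg : Algebra.adjoin K (Set.range g) = ⊤) (δ : A →ₗ[K] A ⊗[K] A) (ε : A →ₗ[K] K)
    (D : A →ₐ[K] A ⊗[K] A) (E : A →ₐ[K] K) (hDδ : D.toLinearMap = δ) (hEε : E.toLinearMap = ε)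
    (hD : ∀ i, D (g i) = g i ⊗ₜ 1 + 1 ⊗ₜ g i) (hE : ∀ i, E (g i) = 0) : Bialgebra K A :=
  letI C : Coalgebra K A :=
    { comul := δ
      counit := ε
      coassoc := by
        subst hDδ
        have h : (Algebra.TensorProduct.assoc K K K A A A).toAlgHom.comp
            ((Algebra.TensorProduct.map D (.id K A)).comp D)
            = (Algebra.TensorProduct.map (.id K A) D).comp D :=
          AlgHom.ext_of_adjoin_eq_top hg (by
            rintro _ ⟨i, rfl⟩
            simp [hD, TensorProduct.add_tmul, TensorProduct.tmul_add,
              Algebra.TensorProduct.one_def, add_assoc])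
        exact congr(($h).toLinearMap)
      rTensor_counit_comp_comul := by
        subst hDδ hEε
        have h : (Algebra.TensorProduct.map E (.id K A)).comp D
            = (Algebra.TensorProduct.lid K A).symm :=
          AlgHom.ext_of_adjoin_eq_top hg (by
            rintro _ ⟨i, rfl⟩
            simp [hD, hE])
        exact congr(($h).toLinearMap)
      lTensor_counit_comp_comul := by
        subst hDδ hEε
        have h : (Algebra.TensorProduct.map (.id K A) E).comp D
            = (Algebra.TensorProduct.rid K K A).symm :=
          AlgHom.ext_of_adjoin_eq_top hg (by
            rintro _ ⟨i, rfl⟩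
            simp [hD, hE])
        exact congr(($h).toLinearMap) }
  Bialgebra.mk' K A
    (by subst hEε; exact map_one E) (by subst hEε; exact map_mul E _ _)
    (by subst hDδ; exact map_one D) (by subst hDδ; exact map_mul D _ _)

/-- A commutative bialgebra generated by primitive elements, with an algebra morphism that negates
the generators, is a Hopf algebra. -/
noncomputable abbrev hopfOfPrimitive {ι A : Type*} [CommRing A] [Bialgebra K A] (g : ι → A)
    (hg : Algebra.adjoin K (Set.range g) = ⊤) (S : A →ₐ[K] A)
    (hD : ∀ i, CoalgebraStruct.comul (R := K) (g i) = g i ⊗ₜ 1 + 1 ⊗ₜ g i)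
    (hE : ∀ i, CoalgebraStruct.counit (R := K) (g i) = 0)
    (hS : ∀ i, S (g i) = -g i) : HopfAlgebra K A :=
  HopfAlgebra.ofAlgHom S
    (AlgHom.ext_of_adjoin_eq_top hg (by
      rintro _ ⟨i, rfl⟩
      have h : ∀ a b : A, Algebra.TensorProduct.lift S (.id K A) (fun _ ↦ Commute.all _)
          (a ⊗ₜ[K] b) = S a * b := fun a b => Algebra.TensorProduct.lift_tmul _ _ _ _ _
      simp [hD, hE, hS, h]))
    (AlgHom.ext_of_adjoin_eq_top hg (by
      rintro _ ⟨i, rfl⟩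
      simp [hD, hE, hS]))

noncomputable instance : Bialgebra K (LambdaTilde K) :=
  bialgebraOfPrimitive (fun n : ℕ+ => tBasis K {n}) tilde_adjoin (coprodTilde K) (counitTilde K)
    (coprodTildeAlg K) (counitTildeAlg K) coprodTildeAlg_eq counitTildeAlg_eq
    (fun n => by simp [coprodTildeAlg, tildeLift_basis])
    (fun n => by simp [counitTildeAlg, tildeLift_basis])

theorem tilde_comul_eq :
    (CoalgebraStruct.comul : LambdaTilde K →ₗ[K] _) = coprodTilde K := rfl

theorem tilde_counit_eq :
    (CoalgebraStruct.counit : LambdaTilde K →ₗ[K] K) = counitTilde K := rfl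

/-- The antipode of `Λ̃`, `m̃_n ↦ -m̃_n`. -/
noncomputable def antipodeTilde (K : Type*) [Field K] [CharZero K] :
    LambdaTilde K →ₐ[K] LambdaTilde K := tildeLift fun n => -tBasis K {n}

noncomputable instance : HopfAlgebra K (LambdaTilde K) :=
  hopfOfPrimitive (fun n : ℕ+ => tBasis K {n}) tilde_adjoin (antipodeTilde K)
    (fun n => by
      rw [tilde_comul_eq, ← coprodTildeAlg_eq]
      simp [coprodTildeAlg, tildeLift_basis])
    (fun n => by
      rw [tilde_counit_eq, ← counitTildeAlg_eq]
      simp [counitTildeAlg, tildeLift_basis])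
    (fun n => by simp [antipodeTilde, tildeLift_basis])

/-- The coefficient of `x^d ⊗ x^e` in an element of `Λ ⊗ Λ`. -/
noncomputable def coco (d e : ℕ →₀ ℕ) : Lambda K ⊗[K] Lambda K →ₗ[K] K :=
  LinearMap.mul' K K ∘ₗ TensorProduct.map (co d) (co e)

theorem coco_tmul (d e : ℕ →₀ ℕ) (f g : Lambda K) : coco d e (f ⊗ₜ[K] g) = co d f * co e g := by
  simp [coco]

theorem coco_sep {x y : Lambda K ⊗[K] Lambda K} (h : ∀ d e, coco d e x = coco d e y) : x = y := by
  refine ((mBasis K).tensorProduct (mBasis K)).ext_elem fun p => ?_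
  have key : ∀ z : Lambda K ⊗[K] Lambda K,
      ((mBasis K).tensorProduct (mBasis K)).repr z p = coco (rep p.1) (rep p.2) z := by
    intro z
    induction z using TensorProduct.induction_on with
    | zero => simp
    | add a b ha hb => simp [ha, hb]
    | tmul a b =>
      rw [coco_tmul, ← mBasis_repr, ← mBasis_repr, ← Prod.mk.eta (p := p),
        Module.Basis.tensorProduct_repr_tmul_apply, smul_eq_mul, mul_comm]
  rw [key, key, h]

theorem co_mul (d : ℕ →₀ ℕ) (f g : Lambda K) :
    co d (f * g) = ∑ p ∈ Finset.HasAntidiagonal.antidiagonal d, co p.1 f * co p.2 g := by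
  classical
  exact MvPowerSeries.coeff_mul d f.1 g.1

theorem coco_mul (d e : ℕ →₀ ℕ) (x y : Lambda K ⊗[K] Lambda K) :
    coco d e (x * y) = ∑ p ∈ Finset.HasAntidiagonal.antidiagonal d ×ˢ
      Finset.HasAntidiagonal.antidiagonal e,
      coco p.1.1 p.2.1 x * coco p.1.2 p.2.2 y := by
  induction x using TensorProduct.induction_on with
  | zero => simp
  | add a b ha hb => simp [add_mul, ha, hb, Finset.sum_add_distrib]
  | tmul a b =>
    induction y using TensorProduct.induction_on with
    | zero => simp
    | add a' b' ha hb => simp only [mul_add, map_add, ha, hb, Finset.sum_add_distrib]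
    | tmul a' b' =>
      rw [Algebra.TensorProduct.tmul_mul_tmul, coco_tmul, co_mul, co_mul, Finset.sum_mul_sum,
        Finset.sum_product]
      refine Finset.sum_congr rfl fun p _ => Finset.sum_congr rfl fun q _ => ?_
      rw [coco_tmul, coco_tmul]; ring

theorem count_antidiagonal (l m : Multiset ℕ+) :
    ((l + m).antidiagonal.count (l, m)) * (multFact l * multFact m) = multFact (l + m) := by
  generalize hs : l + m = s
  induction s using Multiset.induction generalizing l m with
  | empty =>
    obtain ⟨rfl, rfl⟩ : l = 0 ∧ m = 0 := by simpa using hs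
    simp [multFact_zero]
  | cons a s ih =>
    have hinj1 : Function.Injective (Prod.map id (Multiset.cons a) :
        Multiset ℕ+ × Multiset ℕ+ → _) :=
      Function.injective_id.prodMap (fun _ _ h => (Multiset.cons_inj_right a).mp h)
    have hinj2 : Function.Injective (Prod.map (Multiset.cons a) id :
        Multiset ℕ+ × Multiset ℕ+ → _) :=
      Function.Injective.prodMap (fun _ _ h => (Multiset.cons_inj_right a).mp h)
        Function.injective_id
    have h1 : (s.antidiagonal.map (Prod.map id (Multiset.cons a))).count (l, m) *
        (multFact l * multFact m) = multFact s * m.count a := by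
      by_cases ha : a ∈ m
      · obtain ⟨m, rfl⟩ := Multiset.exists_cons_of_mem ha
        have h2 : l + m = s := by simpa [Multiset.add_cons] using hs
        have := Multiset.count_map_eq_count' (Prod.map id (Multiset.cons a)) s.antidiagonal hinj1
          (l, m)
        rw [Prod.map_apply, id] at this
        rw [this, multFact_cons, ← ih l m h2]
        ring
      · rw [Multiset.count_eq_zero_of_notMem (a := a) ha, Multiset.count_eq_zero_of_notMem]
        · simp
        · rintro h
          obtain ⟨p, _, hp⟩ := Multiset.mem_map.mp h
          have h3 : a ::ₘ p.2 = m := (Prod.ext_iff.mp hp).2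
          exact ha (by rw [← h3]; simp)
    have h1' : (s.antidiagonal.map (Prod.map (Multiset.cons a) id)).count (l, m) *
        (multFact l * multFact m) = multFact s * l.count a := by
      by_cases ha : a ∈ l
      · obtain ⟨l, rfl⟩ := Multiset.exists_cons_of_mem ha
        have h2 : l + m = s := by simpa [Multiset.cons_add] using hs
        have := Multiset.count_map_eq_count' (Prod.map (Multiset.cons a) id) s.antidiagonal hinj2
          (l, m)
        rw [Prod.map_apply, id] at this
        rw [this, multFact_cons, ← ih l m h2]
        ring
      · rw [Multiset.count_eq_zero_of_notMem (a := a) ha, Multiset.count_eq_zero_of_notMem]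
        · simp
        · rintro h
          obtain ⟨p, _, hp⟩ := Multiset.mem_map.mp h
          have h3 : a ::ₘ p.1 = l := (Prod.ext_iff.mp hp).1
          exact ha (by rw [← h3]; simp)
    rw [Multiset.antidiagonal_cons, Multiset.count_add, add_mul, h1, h1', multFact_cons, ← hs,
      Multiset.count_add]
    ring

/-- `Δf` is `f` evaluated at two disjoint sets of variables. -/
theorem coco_coprod (f : Lambda K) {d e c : ℕ →₀ ℕ} (h : expType c = expType d + expType e) :
    coco d e (coprod K f) = co c f := by
  suffices H : coco d e ∘ₗ coprod K = co c from LinearMap.congr_fun H f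
  refine (mtBasis K).ext fun l => ?_
  rw [LinearMap.comp_apply, coprod_mt, map_multiset_sum, Multiset.map_map, co_mtBasis, h]
  have h1 : ∀ p : Multiset ℕ+ × Multiset ℕ+,
      (coco d e ∘ fun p : Multiset ℕ+ × Multiset ℕ+ => mtBasis K p.1 ⊗ₜ[K] mtBasis K p.2) p =
      if p = (expType d, expType e) then (multFact (expType d) * multFact (expType e) : K)
      else 0 := by
    intro p
    rw [Function.comp_apply, coco_tmul, co_mtBasis, co_mtBasis]
    by_cases h2 : p = (expType d, expType e)
    · subst h2; simp
    · rw [if_neg h2]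
      by_cases h3 : expType d = p.1
      · rw [if_neg (show ¬ expType e = p.2 from fun h4 => h2 (Prod.ext h3.symm h4.symm)), mul_zero]
      · rw [if_neg h3, zero_mul]
  rw [Multiset.map_congr rfl (fun p _ => h1 p)]
  have h5 : ∀ (s : Multiset (Multiset ℕ+ × Multiset ℕ+)) (a : Multiset ℕ+ × Multiset ℕ+) (r : K),
      (s.map fun p => if p = a then r else 0).sum = (s.count a : K) * r := by
    intro s a r
    induction s using Multiset.induction with
    | empty => simp
    | cons b s ih =>
      rw [Multiset.map_cons, Multiset.sum_cons, ih, Multiset.count_cons]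
      by_cases hb : b = a
      · simp [hb]; ring
      · simp [hb, Ne.symm hb]
  rw [h5]
  split_ifs with h6
  · subst h6
    rw [← count_antidiagonal]
    push_cast
    ring
  · rw [Multiset.count_eq_zero_of_notMem]
    · simp
    · rw [Multiset.mem_antidiagonal]; exact h6

/-- Monomials in two sets of variables, as monomials in one. -/
noncomputable def joinMon : (ℕ →₀ ℕ) × (ℕ →₀ ℕ) ≃+ (ℕ →₀ ℕ) :=
  Finsupp.sumFinsuppAddEquivProdFinsupp.symm.trans (Finsupp.domCongr Equiv.natSumNatEquivNat)

theorem expType_joinMon (p : (ℕ →₀ ℕ) × (ℕ →₀ ℕ)) :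
    expType (joinMon p) = expType p.1 + expType p.2 := by
  have h : joinMon p = (Finsupp.sumFinsuppAddEquivProdFinsupp.symm p).mapDomain
      Equiv.natSumNatEquivNat := by
    simp [joinMon, Finsupp.equivMapDomain_eq_mapDomain]
  have h2 : Finsupp.sumFinsuppAddEquivProdFinsupp.symm p =
      p.1.mapDomain Sum.inl + p.2.mapDomain Sum.inr := by
    ext (i | i)
    · simp [Finsupp.mapDomain_apply Sum.inl_injective]
      rw [Finsupp.mapDomain_of_notMem_range _ _ (by simp)]
    · simp [Finsupp.mapDomain_apply Sum.inr_injective]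
      rw [Finsupp.mapDomain_of_notMem_range _ _ (by simp)]
  classical
  rw [h, expType_mapDomain (Equiv.injective _), h2, expType_add,
    expType_mapDomain Sum.inl_injective, expType_mapDomain Sum.inr_injective]
  rw [Finsupp.mapDomain_support_of_injective Sum.inl_injective,
    Finsupp.mapDomain_support_of_injective Sum.inr_injective, Finset.disjoint_left]
  simp

theorem coprod_mul (f g : Lambda K) : coprod K (f * g) = coprod K f * coprod K g := by
  refine coco_sep fun d e => ?_
  have hJ : ∀ (h : Lambda K) (p : (ℕ →₀ ℕ) × (ℕ →₀ ℕ)),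
      coco p.1 p.2 (coprod K h) = co (joinMon p) h :=
    fun h p => coco_coprod h (expType_joinMon p)
  rw [coco_mul, hJ _ (d, e), co_mul]
  symm
  refine Finset.sum_bij' (fun p _ => (joinMon (p.1.1, p.2.1), joinMon (p.1.2, p.2.2)))
    (fun q _ => (((joinMon.symm q.1).1, (joinMon.symm q.2).1),
      ((joinMon.symm q.1).2, (joinMon.symm q.2).2))) ?_ ?_ ?_ ?_ ?_
  · intro p hp
    rw [Finset.mem_product, Finset.HasAntidiagonal.mem_antidiagonal,
      Finset.HasAntidiagonal.mem_antidiagonal] at hp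
    rw [Finset.HasAntidiagonal.mem_antidiagonal, ← map_add, Prod.mk_add_mk, hp.1, hp.2]
  · intro q hq
    rw [Finset.HasAntidiagonal.mem_antidiagonal] at hq
    have : joinMon.symm q.1 + joinMon.symm q.2 = (d, e) := by
      rw [← map_add, hq, AddEquiv.symm_apply_apply]
    rw [Finset.mem_product, Finset.HasAntidiagonal.mem_antidiagonal,
      Finset.HasAntidiagonal.mem_antidiagonal]
    exact Prod.ext_iff.mp this
  · intro p _; simp
  · intro q _; simp
  · intro p _
    rw [hJ _ (p.1.1, p.2.1), hJ _ (p.1.2, p.2.2)]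

/-- The coproduct of `Λ` as an algebra morphism. -/
noncomputable def coprodAlg (K : Type*) [Field K] [CharZero K] :
    Lambda K →ₐ[K] Lambda K ⊗[K] Lambda K :=
  AlgHom.ofLinearMap (coprod K)
    (by rw [← mtBasis_zero, coprod_mt, Multiset.antidiagonal_zero, Multiset.map_singleton,
        Multiset.sum_singleton, mtBasis_zero]; rfl) coprod_mul


/-- The power sum `p_n = m_n`. -/
noncomputable def psum (K : Type*) [Field K] (n : ℕ+) : Lambda K := mBasis K {n}

theorem multFact_singleton (n : ℕ+) : multFact {n} = 1 := by
  simp [multFact]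

theorem psum_eq_mt (n : ℕ+) : psum K n = mtBasis K {n} := by
  rw [mtBasis_apply, multFact_singleton, Nat.cast_one, one_smul, psum]

theorem coprod_psum (n : ℕ+) : coprod K (psum K n) = psum K n ⊗ₜ 1 + 1 ⊗ₜ psum K n := by
  rw [psum_eq_mt, coprod_mt, ← Multiset.cons_zero, Multiset.antidiagonal_cons]
  simp [mtBasis_zero, add_comm]

/-- Symmetric functions with less than `k` variables in each monomial. -/
def lenLT (K : Type*) [Field K] (k : ℕ) : Submodule K (Lambda K) where
  carrier := {f | ∀ d : ℕ →₀ ℕ, k ≤ d.support.card → co d f = 0}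
  add_mem' := fun hf hg d hd => by rw [map_add, hf d hd, hg d hd, add_zero]
  zero_mem' := fun d _ => map_zero _
  smul_mem' := fun r f hf d hd => by rw [map_smul, hf d hd, smul_zero]

theorem exists_single_of_expType {a : ℕ →₀ ℕ} {n : ℕ+} (h : expType a = {n}) :
    ∃ i, a = Finsupp.single i (n : ℕ) := by
  obtain ⟨s, hs⟩ := exists_perm ((expType_single 0 n).trans h.symm)
  exact ⟨s 0, by rw [← hs, Finsupp.mapDomain_single]⟩

theorem card_support_add_le (a b : ℕ →₀ ℕ) :
    (a + b).support.card ≤ a.support.card + b.support.card := by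
  classical
  exact (Finset.card_le_card Finsupp.support_add).trans (Finset.card_union_le _ _)

theorem co_psum (n : ℕ+) (d : ℕ →₀ ℕ) :
    co d (psum K n) = if expType d = {n} then 1 else 0 := co_mBasis _ _

theorem psum_mul_lenLT (n : ℕ+) {k : ℕ} {f : Lambda K} (hf : f ∈ lenLT K k) :
    psum K n * f ∈ lenLT K (k + 1) := by
  intro d hd
  rw [co_mul]
  refine Finset.sum_eq_zero fun p hp => ?_
  rw [Finset.HasAntidiagonal.mem_antidiagonal] at hp
  rw [co_psum]
  split_ifs with h
  · rw [hf, mul_zero]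
    have h1 := card_support_add_le p.1 p.2
    rw [hp, ← card_expType p.1, h, Multiset.card_singleton] at h1
    omega
  · rw [zero_mul]

theorem eq_erase {d a b : ℕ →₀ ℕ} {n : ℕ+} {l : Multiset ℕ+} (hab : a + b = d)
    (ha : expType a = {n}) (hb : expType b = l) (hd : Multiset.card l + 1 ≤ d.support.card) :
    ∃ i, a = Finsupp.single i (n : ℕ) ∧ b = d.erase i ∧ d i = n ∧ expType d = n ::ₘ l := by
  classical
  obtain ⟨i, rfl⟩ := exists_single_of_expType ha
  have hi : i ∉ b.support := by
    intro hi
    have h1 : d.support ⊆ b.support := by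
      rw [← hab]
      refine Finsupp.support_add.trans (Finset.union_subset ?_ subset_rfl)
      exact Finsupp.support_single_subset.trans (Finset.singleton_subset_iff.mpr hi)
    have := Finset.card_le_card h1
    rw [← card_expType b, hb] at this
    omega
  have hi0 : b i = 0 := by simpa using hi
  refine ⟨i, rfl, ?_, ?_, ?_⟩
  · rw [← hab, Finsupp.erase_add, Finsupp.erase_single, zero_add, Finsupp.erase_of_notMem_support hi]
  · rw [← hab]; simp [hi0]
  · rw [← hab, expType_add, ha, hb, Multiset.singleton_add]
    rw [Finsupp.support_single _ n.ne_zero]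
    simpa using hi

theorem psum_mul_mt (n : ℕ+) (l : Multiset ℕ+) :
    psum K n * mtBasis K l - mtBasis K (n ::ₘ l) ∈ lenLT K (Multiset.card l + 1) := by
  classical
  intro d hd
  rw [map_sub, sub_eq_zero, co_mul, co_mtBasis]
  have hterm : ∀ p ∈ Finset.HasAntidiagonal.antidiagonal d,
      co p.1 (psum K n) * co p.2 (mtBasis K l) ≠ 0 →
      ∃ i, p = (Finsupp.single i (n : ℕ), d.erase i) ∧ d i = n ∧ expType d = n ::ₘ l := by
    intro p hp hne
    rw [Finset.HasAntidiagonal.mem_antidiagonal] at hp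
    rw [co_psum, co_mtBasis] at hne
    have h1 : expType p.1 = {n} := by
      by_contra h; rw [if_neg h, zero_mul] at hne; exact hne rfl
    have h2 : expType p.2 = l := by
      by_contra h; rw [if_neg h, mul_zero] at hne; exact hne rfl
    obtain ⟨i, hi1, hi2, hi3, hi4⟩ := eq_erase hp h1 h2 hd
    exact ⟨i, Prod.ext hi1 hi2, hi3, hi4⟩
  by_cases hty : expType d = n ::ₘ l
  · rw [if_pos hty]
    let I : Finset ℕ := d.support.filter fun i => d i = n
    have hadd : ∀ i ∈ I, Finsupp.single i (n : ℕ) + d.erase i = d := by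
      intro i hi
      rw [← (Finset.mem_filter.mp hi).2, Finsupp.single_add_erase]
    have her : ∀ i ∈ I, expType (d.erase i) = l := by
      intro i hi
      have h1 := congrArg expType (hadd i hi)
      rw [expType_add, expType_single, hty, Multiset.singleton_add] at h1
      · exact (Multiset.cons_inj_right n).mp h1
      · rw [Finsupp.support_single _ n.ne_zero]; simp
    have hsum : ∑ p ∈ Finset.HasAntidiagonal.antidiagonal d,
        co p.1 (psum K n) * co p.2 (mtBasis K l) =
        ∑ i ∈ I, (multFact l : K) := by
      symm
      refine Finset.sum_bij_ne_zero (fun i _ _ => (Finsupp.single i (n : ℕ), d.erase i))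
        ?_ ?_ ?_ ?_
      · intro i hi _
        rw [Finset.HasAntidiagonal.mem_antidiagonal]; exact hadd i hi
      · intro i hi _ j hj _ hij
        exact ((Finsupp.single_left_inj n.ne_zero).mp (Prod.ext_iff.mp hij).1)
      · intro p hp hne
        obtain ⟨i, rfl, hi, _⟩ := hterm p hp hne
        have hiI : i ∈ I := by
          refine Finset.mem_filter.mpr ⟨?_, hi⟩
          rw [Finsupp.mem_support_iff, hi]; exact n.ne_zero
        refine ⟨i, hiI, ?_, rfl⟩
        intro h0
        apply hne
        simp only
        rw [co_mtBasis, if_pos (her i hiI), h0, mul_zero]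
      · intro i hi _
        simp only
        rw [co_psum, if_pos (expType_single i n), co_mtBasis, if_pos (her i hi), one_mul]
    rw [hsum, Finset.sum_const, nsmul_eq_mul, multFact_cons, Nat.cast_mul]
    congr 2
    rw [← hty]
    have h1 := Multiset.count_map_eq_count' (fun n : ℕ+ => (n : ℕ)) (expType d)
      PNat.coe_injective n
    rw [← h1, expType_map, Multiset.count_map, Finset.card_def, Finset.filter_val]
    simp [eq_comm]
  · rw [if_neg hty]
    refine Finset.sum_eq_zero fun p hp => ?_
    by_contra hne
    obtain ⟨_, _, _, h⟩ := hterm p hp hne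
    exact hty h

/-- The algebra morphism `Λ̃ → Λ` sending `m̃_n` to `p_n`. -/
noncomputable def tildeToLambda (K : Type*) [Field K] [CharZero K] :
    LambdaTilde K →ₐ[K] Lambda K := tildeLift (psum K)

theorem tildeToLambda_basis (l : Multiset ℕ+) :
    tildeToLambda K (toTilde K (mtBasis K l)) - mtBasis K l ∈ lenLT K (Multiset.card l) := by
  induction l using Multiset.induction with
  | empty =>
    rw [← tBasis_apply, tildeToLambda, tildeLift_basis, mtBasis_zero]
    simp
  | cons n l ih =>
    have h : tildeToLambda K (toTilde K (mtBasis K (n ::ₘ l))) =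
        psum K n * tildeToLambda K (toTilde K (mtBasis K l)) := by
      simp only [← tBasis_apply, tildeToLambda, tildeLift_basis, Multiset.map_cons,
        Multiset.prod_cons]
    have h2 : tildeToLambda K (toTilde K (mtBasis K (n ::ₘ l))) - mtBasis K (n ::ₘ l) =
        psum K n * (tildeToLambda K (toTilde K (mtBasis K l)) - mtBasis K l) +
          (psum K n * mtBasis K l - mtBasis K (n ::ₘ l)) := by
      rw [h]; ring
    rw [h2, Multiset.card_cons]
    exact Submodule.add_mem _ (psum_mul_lenLT n ih) (psum_mul_mt n l)

theorem tildeToLambda_sub {k : ℕ} {f : Lambda K} (hf : f ∈ lenLT K (k + 1)) :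
    tildeToLambda K (toTilde K f) - f ∈ lenLT K k := by
  let N : Lambda K →ₗ[K] Lambda K :=
    (tildeToLambda K).toLinearMap ∘ₗ (toTilde K).toLinearMap - LinearMap.id
  change N f ∈ _
  rw [← (mtBasis K).linearCombination_repr f, Finsupp.linearCombination_apply, Finsupp.sum,
    map_sum]
  refine Submodule.sum_mem _ fun l hl => ?_
  rw [map_smul]
  refine Submodule.smul_mem _ _ ?_
  have hlen : Multiset.card l ≤ k := by
    by_contra hlt
    apply Finsupp.mem_support_iff.mp hl
    have h0 : (mBasis K).repr f l = 0 := by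
      rw [mBasis_repr]
      apply hf
      rw [← card_expType, expType_rep]; omega
    rw [mtBasis, Module.Basis.repr_isUnitSMul, h0, smul_zero]
  exact fun d hd => tildeToLambda_basis l d (hlen.trans hd)

theorem lenLT_zero {f : Lambda K} (hf : f ∈ lenLT K 0) : f = 0 :=
  Lambda.ext_co fun d => by rw [hf d (Nat.zero_le _), map_zero]

theorem exists_lenLT (f : Lambda K) : ∃ k, f ∈ lenLT K k := by
  obtain ⟨N, hN⟩ := f.2.2
  refine ⟨N + 1, fun d hd => hN d ?_⟩
  have : d.support.card • 1 ≤ d.degree :=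
    Finset.card_nsmul_le_sum _ _ _ fun i hi => Nat.pos_of_ne_zero (Finsupp.mem_support_iff.mp hi)
  simp at this
  omega

theorem tildeToLambda_bijective : Function.Bijective (tildeToLambda K) := by
  constructor
  · rw [injective_iff_map_eq_zero]
    intro x hx
    obtain ⟨f, rfl⟩ := (toTilde K).surjective x
    have h : ∀ k, f ∈ lenLT K k → f = 0 := by
      intro k
      induction k with
      | zero => exact lenLT_zero
      | succ k ih =>
        intro hf
        have := tildeToLambda_sub hf
        rw [hx, zero_sub] at this
        exact ih (by simpa using (lenLT K k).neg_mem this)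
    obtain ⟨k, hk⟩ := exists_lenLT f
    rw [h k hk, map_zero]
  · intro f
    have h : ∀ k, ∀ f ∈ lenLT K k, f ∈ (tildeToLambda K).range := by
      intro k
      induction k with
      | zero => intro f hf; rw [lenLT_zero hf]; exact Subalgebra.zero_mem _
      | succ k ih =>
        intro f hf
        have h1 := ih _ (tildeToLambda_sub hf)
        have h2 : tildeToLambda K (toTilde K f) ∈ (tildeToLambda K).range := ⟨_, rfl⟩
        have := Subalgebra.sub_mem _ h2 h1
        rwa [sub_sub_cancel] at this
    obtain ⟨k, hk⟩ := exists_lenLT f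
    exact h k f hk

theorem lambda_adjoin : Algebra.adjoin K (Set.range (psum K)) = ⊤ := by
  rw [eq_top_iff]
  intro f _
  obtain ⟨x, rfl⟩ := tildeToLambda_bijective.2 f
  have hx : x ∈ Algebra.adjoin K (Set.range fun n : ℕ+ => tBasis K {n}) := by
    rw [tilde_adjoin]; trivial
  have h : tildeToLambda K x ∈ (Algebra.adjoin K
      (Set.range fun n : ℕ+ => tBasis K {n})).map (tildeToLambda K) := ⟨x, hx, rfl⟩
  rw [AlgHom.map_adjoin, ← Set.range_comp] at h
  convert h using 4
  ext n
  simp [tildeToLambda, tildeLift_basis]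

noncomputable instance : Bialgebra K (Lambda K) :=
  bialgebraOfPrimitive (psum K) lambda_adjoin (coprod K) (counitLin K)
    (coprodAlg K) (counitAlg K) rfl rfl coprod_psum
    (fun n => by
      rw [psum_eq_mt]
      exact (counitLin_mt _).trans (by simp))

/-- The antipode of `Λ`, `p_n ↦ -p_n`. -/
noncomputable def antipodeLambda (K : Type*) [Field K] [CharZero K] : Lambda K →ₐ[K] Lambda K :=
  ((tildeToLambda K).comp (antipodeTilde K)).comp
    (AlgEquiv.ofBijective _ (tildeToLambda_bijective (K := K))).symm.toAlgHom

noncomputable instance : HopfAlgebra K (Lambda K) :=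
  hopfOfPrimitive (psum K) lambda_adjoin (antipodeLambda K) coprod_psum
    (fun n => by
      rw [psum_eq_mt]
      exact (counitLin_mt _).trans (by simp))
    (fun n => by
      have h : tildeToLambda K (tBasis K {n}) = psum K n := by
        simp [tildeToLambda, tildeLift_basis]
      have h2 : (AlgEquiv.ofBijective _ (tildeToLambda_bijective (K := K))).symm (psum K n) =
          tBasis K {n} := by
        rw [AlgEquiv.symm_apply_eq]; exact h.symm
      change tildeToLambda K (antipodeTilde K _) = _
      erw [h2]
      rw [antipodeTilde, tildeLift_basis]
      simp [h])

end

/-- The homogeneous symmetric functions of degree `n`. -/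
def Lambda.homog (K : Type*) [Field K] (n : ℕ) : Submodule K (Lambda K) where
  carrier := {f | ∀ d : ℕ →₀ ℕ, d.degree ≠ n → MvPowerSeries.coeff d f.1 = 0}
  add_mem' := fun {f g} hf hg d hd => by
    change MvPowerSeries.coeff d (f.1 + g.1) = 0
    rw [map_add, hf d hd, hg d hd, add_zero]
  zero_mem' := fun d _ => map_zero (MvPowerSeries.coeff d)
  smul_mem' := fun r f hf d hd => by
    change MvPowerSeries.coeff d (r • f.1) = 0
    rw [map_smul, hf d hd, smul_zero]

/-- The grading of `Λ̃` is that of `Λ`. -/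
noncomputable def LambdaTilde.homog (K : Type*) [Field K] (n : ℕ) : Submodule K (LambdaTilde K) :=
  (Lambda.homog K n).map (toTilde K).toLinearMap

/-- A weighted graph: a finite simple graph with positive integer vertex weights. -/
structure WGraph : Type (u + 1) where
  V : Type u
  [fintypeV : Fintype V]
  graph : SimpleGraph V
  weight : V → ℕ+

namespace WGraph
attribute [instance] WGraph.fintypeV

/-- The total weight of a weighted graph. -/
def totalWeight (G : WGraph.{u}) : ℕ := ∑ v, (G.weight v : ℕ)

/-- The complement, with the same vertex weights. -/
def compl (G : WGraph.{u}) : WGraph.{u} where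
  V := G.V
  graph := G.graphᶜ
  weight := G.weight

/-- The induced subgraph on a set of vertices. -/
noncomputable def induce (G : WGraph.{u}) (S : Set G.V) : WGraph.{u} where
  V := S
  fintypeV := Fintype.ofFinite S
  graph := G.graph.induce S
  weight := fun v => G.weight v

/-- The disjoint union of a finite family of weighted graphs. -/
def disjointUnion {ι : Type} [Fintype ι] (G : ι → WGraph.{u}) : WGraph.{u} where
  V := Σ i, (G i).V
  graph :=
    { Adj := fun x y => ∃ (i : ι) (u v : (G i).V), (G i).graph.Adj u v ∧ x = ⟨i, u⟩ ∧ y = ⟨i, v⟩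
      symm := ⟨fun _ _ ⟨i, u, v, h, hx, hy⟩ => ⟨i, v, u, h.symm, hy, hx⟩⟩
      loopless := ⟨fun x ⟨i, u, v, h, hx, hy⟩ => by
        subst hx
        obtain ⟨_, h2⟩ := Sigma.mk.inj hy
        exact h.ne (eq_of_heq h2)⟩ }
  weight := fun x => (G x.1).weight x.2

/-- `G_λ = G_{λ_1} ⊔ ⋯ ⊔ G_{λ_ℓ}`, the partition `λ` being the multiset of its parts. -/
def ofPartition (G : ℕ+ → WGraph.{u}) (l : Multiset ℕ+) : WGraph.{u} :=
  disjointUnion fun i : l => G i.1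

/-- Isomorphisms of weighted graphs: graph isomorphisms that preserve the vertex weights. -/
structure Iso (G : WGraph.{u}) (H : WGraph.{v}) where
  toIso : G.graph ≃g H.graph
  weight_eq : ∀ x, H.weight (toIso x) = G.weight x

/-- The exponent vector of `∏_v x_{κ(v)}^{w(v)}`. -/
noncomputable def colorMon (G : WGraph.{u}) (c : G.V → ℕ) : ℕ →₀ ℕ :=
  ∑ v, Finsupp.single (c v) (G.weight v : ℕ)

theorem degree_colorMon (G : WGraph.{u}) (c : G.V → ℕ) : (G.colorMon c).degree = G.totalWeight := by
  simp [colorMon, totalWeight]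

theorem finite_colorings (G : WGraph.{u}) (d : ℕ →₀ ℕ) :
    Finite {c : G.graph.Coloring ℕ // G.colorMon c = d} := by
  have h : ∀ (c : {c : G.graph.Coloring ℕ // G.colorMon c = d}) (v : G.V), c.1 v ∈ d.support := by
    rintro ⟨c, rfl⟩ v
    rw [Finsupp.mem_support_iff]
    change (∑ v, Finsupp.single (c v) (G.weight v : ℕ)) (c v) ≠ 0
    rw [Finsupp.finsetSum_apply]
    refine (Finset.sum_pos' (fun _ _ => Nat.zero_le _) ⟨v, Finset.mem_univ _, ?_⟩).ne'
    simp
  refine Finite.of_injective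
    (fun c v => (⟨c.1 v, h c v⟩ : d.support)) ?_
  intro c c' hcc
  apply Subtype.ext
  apply DFunLike.ext
  intro v
  exact congrArg Subtype.val (congrFun hcc v)

/-- The chromatic symmetric function `X_G = ∑_κ ∏_v x_{κ(v)}^{w(v)}`, the sum over proper colorings
`κ : V → ℕ`: the coefficient of `x^d` is the (finite) number of proper colorings `κ` with
`∏_v x_{κ(v)}^{w(v)} = x^d`. -/
noncomputable def csf (K : Type*) [Field K] (G : WGraph.{u}) : Lambda K :=
  ⟨fun d => (Nat.card {c : G.graph.Coloring ℕ // G.colorMon c = d} : K), by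
    refine ⟨fun s d => congrArg (Nat.cast : ℕ → K) ?_, G.totalWeight, fun d hd => ?_⟩
    · symm
      have hmap : ∀ (t : Equiv.Perm ℕ) (c : G.V → ℕ),
          G.colorMon (fun v => t (c v)) = (G.colorMon c).mapDomain t := by
        intro t c
        simp [colorMon, Finsupp.mapDomain_finsetSum, Finsupp.mapDomain_single]
      let r : Equiv.Perm ℕ → G.graph.Coloring ℕ → G.graph.Coloring ℕ := fun t c =>
        SimpleGraph.Coloring.mk (fun v => t (c v)) fun h => t.injective.ne (c.valid h)
      have hr : ∀ (t : Equiv.Perm ℕ) (c : G.graph.Coloring ℕ),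
          G.colorMon (r t c) = (G.colorMon c).mapDomain t := fun t c => hmap t c
      refine Nat.card_congr
        { toFun := fun c => ⟨r s c.1, by rw [hr, c.2]⟩
          invFun := fun c => ⟨r s.symm c.1, by
            rw [hr, c.2, ← Finsupp.mapDomain_comp]; simp⟩
          left_inv := fun c => Subtype.ext (DFunLike.ext _ _ fun v => s.symm_apply_apply _)
          right_inv := fun c => Subtype.ext (DFunLike.ext _ _ fun v => s.apply_symm_apply _) }
    · have : IsEmpty {c : G.graph.Coloring ℕ // G.colorMon c = d} := by
        refine ⟨fun c => ?_⟩
        have := G.degree_colorMon c.1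
        rw [c.2] at this
        omega
      change ((Nat.card {c : G.graph.Coloring ℕ // G.colorMon c = d} : ℕ) : K) = 0
      rw [Nat.card_of_isEmpty, Nat.cast_zero]⟩

end WGraph

end SymF

namespace SymF

/-! ### Splittings of a monomial -/

/-! The `X_{G_λ}` form a basis of `Λ`. By deletion and contraction, `X_H` for a connected `H` of
total weight `N` is `a p_N` plus a polynomial in the `p_k` with `k < N`, where `a` is the signed
number of connected spanning subgraphs. All contributions to `a` in the deletion-contraction
recursion have the sign `(-1)^(|V|-1)`, so `a ≠ 0` (`connSum_pos`, `csf_leading`). Hence the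
`X_{G_n}` are polynomial generators of `Λ` (`tildeLift_bijective`), and `φ` is the algebra morphism
with `X_{G_n} ↦ X_{compl G_n}`.

It has the required values on all `X_{G_λ}` because `⊙` multiplies only monomials in disjoint sets
of variables (`co_tilde_mul`), while in the complement of a disjoint union the two sides must use
disjoint sets of colors. So `H ↦ X_{compl H}` turns disjoint unions into `⊙`-products
(`Split.csf_compl`).

For the coproduct, `Δ X_H` is the sum of `X_{H|S} ⊗ X_{H|Sᶜ}` over sets `S` of vertices
(`coprod_csf`), and complementation commutes with passing to induced subgraphs. Each induced
subgraph of `G_n` is a disjoint union of graphs `G_i`, so `φ` complements it too (`map_csf_induce`),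
and the two coproducts agree term by term.

Finally, `φ(p_n)` is primitive of degree `n`, hence equal to `c_n m̃_n` (`eq_smul_of_primitive`). So
the coefficient of `m̃_n` in `φ(X_{G_n}) = X_{compl G_n}` is `a_n c_n`: the lower terms of `X_{G_n}`
contribute nothing (`co_adjoin_lt`). If `φ` is injective, `c_n ≠ 0`, so the complement of `G_n` has
a proper coloring with one color. It then has no edges, and `G_n` is a clique. -/

theorem multiset_antidiagonal_map {α β : Type*} (g : α → β) (s : Multiset α) :
    (s.map g).antidiagonal = s.antidiagonal.map (Prod.map (Multiset.map g) (Multiset.map g)) := by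
  induction s using Multiset.induction with
  | empty => simp
  | cons a s ih =>
    rw [Multiset.map_cons, Multiset.antidiagonal_cons, Multiset.antidiagonal_cons, ih]
    simp only [Multiset.map_add, Multiset.map_map]
    congr 1 <;> refine Multiset.map_congr rfl fun p _ => ?_ <;> simp [Prod.map]

theorem finset_antidiagonal_val {α : Type*} [DecidableEq α] (s : Finset α) :
    s.val.antidiagonal = s.powerset.val.map fun t => (t.val, (s \ t).val) := by
  induction s using Finset.induction with
  | empty => simp
  | insert a s ha ih =>
    have hdisj : Disjoint s.powerset (s.powerset.image (insert a)) := by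
      rw [Finset.disjoint_left]
      intro t ht ht2
      obtain ⟨t', _, rfl⟩ := Finset.mem_image.mp ht2
      exact ha (Finset.mem_powerset.mp ht (Finset.mem_insert_self _ _))
    have hinj : Set.InjOn (insert a : Finset α → Finset α) s.powerset := by
      intro x hx y hy hxy
      have hx' : a ∉ x := fun h => ha (Finset.mem_powerset.mp hx h)
      have hy' : a ∉ y := fun h => ha (Finset.mem_powerset.mp hy h)
      rw [← Finset.erase_insert hx', ← Finset.erase_insert hy']
      exact congrArg (fun z => Finset.erase z a) hxy
    have hu : (insert a s).powerset.val = s.powerset.val + s.powerset.val.map (insert a) := by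
      rw [Finset.powerset_insert, ← Finset.disjUnion_eq_union _ _ hdisj]
      simp only [Finset.disjUnion]
      rw [Finset.image_val_of_injOn hinj]
    rw [hu, Finset.insert_val_of_notMem ha, Multiset.antidiagonal_cons, ih, Multiset.map_add,
      Multiset.map_map, Multiset.map_map, Multiset.map_map]
    congr 1
    · refine Multiset.map_congr rfl fun t ht => ?_
      have hat : a ∉ t := fun h => ha (Finset.mem_powerset.mp (Finset.mem_def.mpr ht) h)
      simp only [Function.comp, Prod.map, id]
      rw [Finset.insert_sdiff_of_notMem _ hat, Finset.insert_val_of_notMem]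
      simp [ha]
    · refine Multiset.map_congr rfl fun t ht => ?_
      have hat : a ∉ t := fun h => ha (Finset.mem_powerset.mp (Finset.mem_def.mpr ht) h)
      simp only [Function.comp, Prod.map, id]
      rw [Finset.insert_val_of_notMem hat, Finset.insert_sdiff_insert,
        Finset.sdiff_insert_of_notMem ha]

theorem expType_eq_map {σ : Type*} (d : σ →₀ ℕ) :
    expType d = d.support.val.map fun i => (d i).toPNat' := by
  apply Multiset.map_injective PNat.coe_injective
  rw [expType_map, Multiset.map_map]
  refine Multiset.map_congr rfl fun i hi => ?_
  have : 0 < d i := Nat.pos_of_ne_zero (Finsupp.mem_support_iff.mp (Finset.mem_def.mpr hi))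
  simp [this]

/-- `Multiset.antidiagonal` treats equal parts as distinguishable, so the splittings of the
exponents of `d` correspond to the subsets of its support. Such a subset is the same as a
decomposition of `d` into two exponent vectors with disjoint supports. -/
theorem antidiagonal_expType {σ : Type*} [DecidableEq σ] (d : σ →₀ ℕ) :
    (expType d).antidiagonal = ((Finset.HasAntidiagonal.antidiagonal d).filter
      fun p => Disjoint p.1.support p.2.support).val.map fun p => (expType p.1, expType p.2) := by
  have h1 : ((Finset.HasAntidiagonal.antidiagonal d).filter
      fun p => Disjoint p.1.support p.2.support) =
      d.support.powerset.image fun t => (d.filter (· ∈ t), d.filter (· ∉ t)) := by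
    ext ⟨p, q⟩
    simp only [Finset.mem_filter, Finset.mem_image, Finset.mem_powerset,
      Finset.HasAntidiagonal.mem_antidiagonal, Prod.mk.injEq]
    constructor
    · rintro ⟨rfl, hd⟩
      refine ⟨p.support, ?_, ?_, ?_⟩
      · intro i hi
        simp only [Finsupp.mem_support_iff, Finsupp.add_apply] at hi ⊢
        omega
      · ext i
        by_cases hi : i ∈ p.support
        · have := Finset.disjoint_left.mp hd hi
          simp only [Finsupp.mem_support_iff, not_not] at this
          rw [Finsupp.filter_apply, if_pos hi, Finsupp.add_apply, this, add_zero]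
        · rw [Finsupp.filter_apply, if_neg hi]
          simpa [eq_comm] using hi
      · ext i
        by_cases hi : i ∈ p.support
        · have := Finset.disjoint_left.mp hd hi
          simp only [Finsupp.mem_support_iff, not_not] at this
          rw [Finsupp.filter_apply, if_neg (not_not.mpr hi), this]
        · rw [Finsupp.filter_apply, if_pos hi, Finsupp.add_apply]
          simp only [Finsupp.mem_support_iff, not_not] at hi
          rw [hi, zero_add]
    · rintro ⟨t, _, rfl, rfl⟩
      refine ⟨Finsupp.filter_add_filter_not d _, ?_⟩
      rw [Finset.disjoint_left]
      intro i
      simp only [Finsupp.support_filter, Finset.mem_filter]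
      tauto
  have hinj : Set.InjOn (fun t : Finset σ => (d.filter (· ∈ t), d.filter (· ∉ t)))
      d.support.powerset := by
    intro x hx y hy hxy
    have h2 := congrArg Finsupp.support (Prod.ext_iff.mp hxy).1
    simp only [Finsupp.support_filter] at h2
    have hx' : x ⊆ d.support := Finset.mem_powerset.mp hx
    have hy' : y ⊆ d.support := Finset.mem_powerset.mp hy
    rwa [Finset.filter_mem_eq_inter, Finset.filter_mem_eq_inter,
      Finset.inter_eq_right.mpr hx', Finset.inter_eq_right.mpr hy'] at h2
  rw [h1, Finset.image_val_of_injOn hinj, Multiset.map_map, expType_eq_map,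
    multiset_antidiagonal_map, finset_antidiagonal_val, Multiset.map_map]
  refine Multiset.map_congr rfl fun t ht => ?_
  have ht' : t ⊆ d.support := Finset.mem_powerset.mp (Finset.mem_def.mpr ht)
  simp only [Function.comp, Prod.map, Prod.mk.injEq]
  constructor
  · have hs : (d.filter (· ∈ t)).support = t := by
      rw [Finsupp.support_filter, Finset.filter_mem_eq_inter, Finset.inter_eq_right.mpr ht']
    rw [expType_eq_map, hs]
    refine Multiset.map_congr rfl fun i hi => ?_
    rw [Finsupp.filter_apply, if_pos (Finset.mem_def.mpr hi)]
  · have hs : (d.filter (· ∉ t)).support = d.support \ t := by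
      rw [Finsupp.support_filter, Finset.filter_notMem_eq_sdiff]
    rw [expType_eq_map, hs]
    refine Multiset.map_congr rfl fun i hi => ?_
    rw [Finsupp.filter_apply, if_pos (Finset.mem_sdiff.mp (Finset.mem_def.mpr hi)).2]

/-! ### The product of `Λ̃` on coefficients -/

section

variable {K : Type*} [Field K] [CharZero K]

/-- The coefficients of a product in `Λ̃`: only disjoint monomials are multiplied. -/
theorem co_tilde_mul (d : ℕ →₀ ℕ) (f g : Lambda K) :
    co d ((toTilde K).symm (toTilde K f * toTilde K g)) =
      ∑ p ∈ (Finset.HasAntidiagonal.antidiagonal d).filter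
        (fun p => Disjoint p.1.support p.2.support), co p.1 f * co p.2 g := by
  -- Both sides are bilinear, which reduces the claim to `f = m̃_l` and `g = m̃_m`.
  have hf : f ∈ Submodule.span K (Set.range (mtBasis K)) := by
    rw [(mtBasis K).span_eq]; trivial
  have hg : g ∈ Submodule.span K (Set.range (mtBasis K)) := by
    rw [(mtBasis K).span_eq]; trivial
  induction hf using Submodule.span_induction with
  | zero => simp
  | add x y _ _ hx hy => simp only [map_add, add_mul, hx, hy, Finset.sum_add_distrib]
  | smul r x _ hx =>
    simp only [map_smul, smul_mul_assoc, hx, Finset.smul_sum]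
  | mem x hx =>
    obtain ⟨l, rfl⟩ := hx
    induction hg using Submodule.span_induction with
    | zero => simp
    | add x y _ _ hx hy => simp only [map_add, mul_add, hx, hy, Finset.sum_add_distrib]
    | smul r x _ hx =>
      simp only [map_smul, mul_smul_comm, hx, Finset.smul_sum]
    | mem x hx =>
      obtain ⟨m, rfl⟩ := hx
      rw [← tBasis_apply, ← tBasis_apply, ← tBasis_add, tBasis_apply, LinearEquiv.symm_apply_apply,
        co_mtBasis]
      have h1 : ∀ p : (ℕ →₀ ℕ) × (ℕ →₀ ℕ), co p.1 (mtBasis K l) * co p.2 (mtBasis K m) =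
          if (l, m) = (expType p.1, expType p.2) then (multFact l * multFact m : K) else 0 := by
        intro p
        rw [co_mtBasis, co_mtBasis]
        simp only [Prod.mk.injEq, eq_comm (a := l), eq_comm (a := m)]
        by_cases h1 : expType p.1 = l <;> by_cases h2 : expType p.2 = m <;> simp [h1, h2]
      rw [Finset.sum_congr rfl fun p _ => h1 p, ← Finset.sum_filter, Finset.sum_const,
        nsmul_eq_mul]
      have h2 := count_antidiagonal l m
      -- The number of nonzero terms is the multiplicity of `(l, m)` among the splittings of the
      -- parts of `d`. By `count_antidiagonal` it makes up for the difference between `multFact l *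
      -- multFact m` and `multFact (l + m)`.
      have h3 : (expType d).antidiagonal.count (l, m) = (((Finset.HasAntidiagonal.antidiagonal d).filter
        (fun p => Disjoint p.1.support p.2.support)).filter
          fun p => (l, m) = (expType p.1, expType p.2)).card := by
        rw [antidiagonal_expType, Multiset.count_map]
        simp only [Finset.card_def, Finset.filter_val]
      rw [← h3]
      split_ifs with h
      · rw [h, ← h2]; push_cast; ring
      · rw [Multiset.count_eq_zero_of_notMem]
        · simp
        · rw [Multiset.mem_antidiagonal]; exact fun h' => h h'.symm

end

/-! ### Chromatic symmetric functions of disjoint unions and of their complements -/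

namespace WGraph

section

variable {K : Type*} [Field K] [CharZero K]

/-- Proper colorings with a given monomial, as functions. -/
def PropCol (G : WGraph.{u}) (d : ℕ →₀ ℕ) : Type u :=
  {c : G.V → ℕ // (∀ x y, G.graph.Adj x y → c x ≠ c y) ∧ G.colorMon c = d}

def coloringEquiv (G : WGraph.{u}) (d : ℕ →₀ ℕ) :
    {c : G.graph.Coloring ℕ // G.colorMon c = d} ≃ G.PropCol d where
  toFun c := ⟨c.1, fun _ _ h => c.1.valid h, c.2⟩
  invFun c := ⟨SimpleGraph.Coloring.mk c.1 fun h => c.2.1 _ _ h, c.2.2⟩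
  left_inv _ := rfl
  right_inv _ := rfl

instance (G : WGraph.{u}) (d : ℕ →₀ ℕ) : Finite (G.PropCol d) :=
  have := G.finite_colorings d
  Finite.of_equiv _ (G.coloringEquiv d)

theorem co_csf (G : WGraph.{u}) (d : ℕ →₀ ℕ) : co d (G.csf K) = (Nat.card (G.PropCol d) : K) := by
  rw [← Nat.card_congr (G.coloringEquiv d)]; rfl

theorem colorMon_apply_pos (G : WGraph.{u}) (c : G.V → ℕ) (v : G.V) : 0 < G.colorMon c (c v) := by
  rw [colorMon, Finsupp.finsetSum_apply]
  refine Finset.sum_pos' (fun _ _ => Nat.zero_le _) ⟨v, Finset.mem_univ _, ?_⟩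
  simp

theorem mem_support_colorMon (G : WGraph.{u}) (c : G.V → ℕ) (i : ℕ) :
    i ∈ (G.colorMon c).support ↔ ∃ v, c v = i := by
  constructor
  · intro h
    by_contra hne
    rw [not_exists] at hne
    rw [Finsupp.mem_support_iff, colorMon, Finsupp.finsetSum_apply] at h
    exact h (Finset.sum_eq_zero fun v _ => Finsupp.single_eq_of_ne (Ne.symm (hne v)))
  · rintro ⟨v, rfl⟩
    exact Finsupp.mem_support_iff.mpr (G.colorMon_apply_pos c v).ne'

theorem csf_homog (G : WGraph.{u}) : G.csf K ∈ Lambda.homog K G.totalWeight := by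
  intro d hd
  change co d (G.csf K) = 0
  have : IsEmpty (G.PropCol d) := ⟨fun c => hd (by rw [← c.2.2, degree_colorMon])⟩
  rw [co_csf, Nat.card_of_isEmpty, Nat.cast_zero]

theorem csf_congr {G : WGraph.{u}} {H : WGraph.{v}} (e : G.V ≃ H.V)
    (hw : ∀ x, H.weight (e x) = G.weight x)
    (ha : ∀ x y, H.graph.Adj (e x) (e y) ↔ G.graph.Adj x y) : G.csf K = H.csf K := by
  have hm : ∀ c : H.V → ℕ, G.colorMon (fun x => c (e x)) = H.colorMon c := by
    intro c
    simp only [colorMon]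
    rw [← e.sum_comp]
    simp only [hw]
  refine Lambda.ext_co fun d => ?_
  rw [co_csf, co_csf]
  congr 1
  refine Nat.card_congr (Equiv.subtypeEquiv (e.arrowCongr (Equiv.refl ℕ)) fun c => ?_)
  have h1 : ∀ x, (e.arrowCongr (Equiv.refl ℕ)) c (e x) = c x := fun x => by simp
  constructor
  · rintro ⟨h, h'⟩
    refine ⟨fun x y hxy => ?_, ?_⟩
    · obtain ⟨x, rfl⟩ := e.surjective x
      obtain ⟨y, rfl⟩ := e.surjective y
      rw [h1, h1]
      exact h _ _ ((ha _ _).mp hxy)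
    · rw [← hm]; simpa only [h1] using h'
  · rintro ⟨h, h'⟩
    refine ⟨fun x y hxy => ?_, ?_⟩
    · rw [← h1 x, ← h1 y]
      exact h _ _ ((ha _ _).mpr hxy)
    · rw [← hm] at h'; simpa only [h1] using h'

theorem csf_congr_iso {G : WGraph.{u}} {H : WGraph.{v}} (e : G.Iso H) : G.csf K = H.csf K :=
  csf_congr e.toIso.toEquiv e.weight_eq fun _ _ => e.toIso.map_rel_iff

theorem csf_compl_congr_iso {G : WGraph.{u}} {H : WGraph.{v}} (e : G.Iso H) :
    G.compl.csf K = H.compl.csf K := by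
  have h : ∀ x y : G.V, H.graphᶜ.Adj (e.toIso x) (e.toIso y) ↔ G.graphᶜ.Adj x y := fun x y => by
    rw [SimpleGraph.compl_adj, SimpleGraph.compl_adj, e.toIso.injective.ne_iff,
      e.toIso.map_rel_iff]
  exact csf_congr (G := G.compl) (H := H.compl) e.toIso.toEquiv e.weight_eq h

theorem csf_empty (G : WGraph.{u}) [IsEmpty G.V] : G.csf K = 1 := by
  refine Lambda.ext_co fun d => ?_
  rw [co_csf]
  change _ = MvPowerSeries.coeff d (1 : MvPowerSeries ℕ K)
  classical
  rw [MvPowerSeries.coeff_one]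
  split_ifs with h
  · subst h
    have : Nat.card (G.PropCol 0) = 1 := by
      rw [Nat.card_eq_one_iff_unique]
      refine ⟨⟨fun a b => Subtype.ext (funext fun x => isEmptyElim x)⟩,
        ⟨⟨fun x => isEmptyElim x, fun x => isEmptyElim x, by simp [colorMon]⟩⟩⟩
    rw [this, Nat.cast_one]
  · have : IsEmpty (G.PropCol d) := ⟨fun c => h (by rw [← c.2.2]; simp [colorMon])⟩
    rw [Nat.card_of_isEmpty, Nat.cast_zero]

/-- `H` is the disjoint union of `A` and `B`. -/
structure Split (A : WGraph.{u}) (B : WGraph.{v}) (H : WGraph.{u}) where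
  e : A.V ⊕ B.V ≃ H.V
  weight_inl : ∀ x, H.weight (e (Sum.inl x)) = A.weight x
  weight_inr : ∀ x, H.weight (e (Sum.inr x)) = B.weight x
  adj_inl : ∀ x y, H.graph.Adj (e (Sum.inl x)) (e (Sum.inl y)) ↔ A.graph.Adj x y
  adj_inr : ∀ x y, H.graph.Adj (e (Sum.inr x)) (e (Sum.inr y)) ↔ B.graph.Adj x y
  not_adj : ∀ x y, ¬ H.graph.Adj (e (Sum.inl x)) (e (Sum.inr y))

/-- Counting colorings of a graph whose vertices are split in two parts. -/
theorem card_propCol {A : WGraph.{u}} {B : WGraph.{v}} {H : WGraph.{u}} (e : A.V ⊕ B.V ≃ H.V)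
    (hl : ∀ x, H.weight (e (Sum.inl x)) = A.weight x)
    (hr : ∀ x, H.weight (e (Sum.inr x)) = B.weight x)
    (R : (ℕ →₀ ℕ) × (ℕ →₀ ℕ) → Prop) [DecidablePred R]
    (hR : ∀ c : H.V → ℕ, (∀ x y, H.graph.Adj x y → c x ≠ c y) ↔
      (∀ x y, A.graph.Adj x y → c (e (Sum.inl x)) ≠ c (e (Sum.inl y))) ∧
      (∀ x y, B.graph.Adj x y → c (e (Sum.inr x)) ≠ c (e (Sum.inr y))) ∧
      R (A.colorMon fun x => c (e (Sum.inl x)), B.colorMon fun x => c (e (Sum.inr x))))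
    (d : ℕ →₀ ℕ) :
    Nat.card (H.PropCol d) = ∑ p ∈ (Finset.HasAntidiagonal.antidiagonal d).filter R,
      Nat.card (A.PropCol p.1) * Nat.card (B.PropCol p.2) := by
  have hm : ∀ c : H.V → ℕ, A.colorMon (fun x => c (e (Sum.inl x))) +
      B.colorMon (fun x => c (e (Sum.inr x))) = H.colorMon c := by
    intro c
    simp only [colorMon]
    rw [← e.sum_comp, Fintype.sum_sum_type]
    simp only [hl, hr]
  let F := (Finset.HasAntidiagonal.antidiagonal d).filter R
  -- A coloring of `H` is a pair of colorings of the parts, sorted by their two monomials. The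
  -- predicate `R` on these monomials carries whatever the edges between the parts impose.
  let E : H.PropCol d ≃ Σ p : F, A.PropCol p.1.1 × B.PropCol p.1.2 :=
    { toFun := fun c => ⟨⟨(A.colorMon fun x => c.1 (e (Sum.inl x)),
          B.colorMon fun x => c.1 (e (Sum.inr x))), Finset.mem_filter.mpr
            ⟨Finset.HasAntidiagonal.mem_antidiagonal.mpr ((hm _).trans c.2.2),
              ((hR c.1).mp c.2.1).2.2⟩⟩,
        ⟨fun x => c.1 (e (Sum.inl x)), ((hR c.1).mp c.2.1).1, rfl⟩,
        ⟨fun x => c.1 (e (Sum.inr x)), ((hR c.1).mp c.2.1).2.1, rfl⟩⟩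
      invFun := fun q => ⟨fun v => Sum.elim q.2.1.1 q.2.2.1 (e.symm v), by
        obtain ⟨⟨p, hp⟩, ⟨a, ha, ha'⟩, ⟨b, hb, hb'⟩⟩ := q
        obtain ⟨h1, h2⟩ := Finset.mem_filter.mp hp
        dsimp only at ha' hb'
        constructor
        · rw [hR]
          simp only [Equiv.symm_apply_apply, Sum.elim_inl, Sum.elim_inr]
          refine ⟨ha, hb, ?_⟩
          rw [ha', hb']
          exact h2
        · rw [← hm]
          simp only [Equiv.symm_apply_apply, Sum.elim_inl, Sum.elim_inr]
          rw [ha', hb']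
          exact Finset.HasAntidiagonal.mem_antidiagonal.mp h1⟩
      left_inv := fun c => by
        apply Subtype.ext
        funext v
        obtain ⟨x | x, rfl⟩ := e.surjective v <;> simp
      right_inv := fun q => by
        obtain ⟨⟨⟨p, p'⟩, hp⟩, ⟨a, ha, ha'⟩, ⟨b, hb, hb'⟩⟩ := q
        dsimp only at ha' hb'
        subst ha' hb'
        -- The monomials index the sigma type, so both colorings are replaced at once to avoid a
        -- comparison across different indices.
        have key : ∀ (a' : A.V → ℕ) (b' : B.V → ℕ) (h1 : ∀ x y, A.graph.Adj x y → a' x ≠ a' y)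
            (h2 : ∀ x y, B.graph.Adj x y → b' x ≠ b' y) (h3 : (A.colorMon a', B.colorMon b') ∈ F),
            a' = a → b' = b →
            (⟨⟨(A.colorMon a', B.colorMon b'), h3⟩, ⟨a', h1, rfl⟩, ⟨b', h2, rfl⟩⟩ :
              Σ p : F, A.PropCol p.1.1 × B.PropCol p.1.2) =
              ⟨⟨(A.colorMon a, B.colorMon b), hp⟩, ⟨a, ha, rfl⟩, ⟨b, hb, rfl⟩⟩ := by
          rintro _ _ _ _ _ rfl rfl
          rfl
        refine key _ _ ?_ ?_ ?_ (funext fun x => by simp) (funext fun x => by simp)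
        · exact fun x y hxy => by simpa using ha x y hxy
        · exact fun x y hxy => by simpa using hb x y hxy }
  rw [Nat.card_congr E, Nat.card_sigma]
  simp only [Nat.card_prod]
  exact Finset.sum_coe_sort F fun p => Nat.card (A.PropCol p.1) * Nat.card (B.PropCol p.2)

/-- Without edges between the parts, the two colorings are independent, so `R` is trivially true and
the count is the coefficient of an ordinary product. -/
theorem Split.csf {A : WGraph.{u}} {B : WGraph.{v}} {H : WGraph.{u}} (s : Split A B H) :
    H.csf K = A.csf K * B.csf K := by
  classical
  refine Lambda.ext_co fun d => ?_
  rw [co_mul, co_csf, card_propCol s.e s.weight_inl s.weight_inr (fun _ => True)]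
  · simp [co_csf]
  · intro c
    constructor
    · intro h
      exact ⟨fun x y hxy => h _ _ ((s.adj_inl x y).mpr hxy),
        fun x y hxy => h _ _ ((s.adj_inr x y).mpr hxy), trivial⟩
    · rintro ⟨h1, h2, _⟩ x y hxy
      obtain ⟨x | x, rfl⟩ := s.e.surjective x <;> obtain ⟨y | y, rfl⟩ := s.e.surjective y
      · exact h1 _ _ ((s.adj_inl _ _).mp hxy)
      · exact absurd hxy (s.not_adj _ _)
      · exact absurd hxy.symm (s.not_adj _ _)
      · exact h2 _ _ ((s.adj_inr _ _).mp hxy)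

/-- In the complement every vertex of `A` is adjacent to every vertex of `B`. The only new condition
is that the two color sets are disjoint, which depends on the monomials alone and is exactly the
restriction in `co_tilde_mul`. -/
theorem Split.csf_compl {A : WGraph.{u}} {B : WGraph.{v}} {H : WGraph.{u}}
    (s : Split A B H) :
    toTilde K (H.compl.csf K) = toTilde K (A.compl.csf K) * toTilde K (B.compl.csf K) := by
  classical
  apply (toTilde K).symm.injective
  rw [LinearEquiv.symm_apply_apply]
  refine Lambda.ext_co fun d => ?_
  rw [co_tilde_mul, co_csf, card_propCol (A := A.compl) (B := B.compl) (H := H.compl)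
    s.e s.weight_inl s.weight_inr (fun p => Disjoint p.1.support p.2.support)]
  · simp [co_csf]
  · intro c
    change (∀ x y, H.graphᶜ.Adj x y → c x ≠ c y) ↔
      (∀ x y, A.graphᶜ.Adj x y → c (s.e (Sum.inl x)) ≠ c (s.e (Sum.inl y))) ∧
      (∀ x y, B.graphᶜ.Adj x y → c (s.e (Sum.inr x)) ≠ c (s.e (Sum.inr y))) ∧ _
    simp only [SimpleGraph.compl_adj, Finset.disjoint_left, mem_support_colorMon]
    constructor
    · intro h
      refine ⟨fun x y hxy => h _ _ ⟨?_, ?_⟩, fun x y hxy => h _ _ ⟨?_, ?_⟩, ?_⟩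
      · simpa using hxy.1
      · rw [s.adj_inl]; exact hxy.2
      · simpa using hxy.1
      · rw [s.adj_inr]; exact hxy.2
      · rintro i ⟨x, rfl⟩ ⟨y, hy⟩
        exact h (s.e (Sum.inl x)) (s.e (Sum.inr y)) ⟨by simp, s.not_adj _ _⟩ hy.symm
    · rintro ⟨h1, h2, h3⟩ x y ⟨hne, hxy⟩
      obtain ⟨x | x, rfl⟩ := s.e.surjective x <;> obtain ⟨y | y, rfl⟩ := s.e.surjective y
      · exact h1 _ _ ⟨by simpa using hne, by rwa [s.adj_inl] at hxy⟩
      · exact fun h => h3 ⟨x, rfl⟩ ⟨y, h.symm⟩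
      · exact fun h => h3 ⟨y, rfl⟩ ⟨x, h⟩
      · exact h2 _ _ ⟨by simpa using hne, by rwa [s.adj_inr] at hxy⟩

theorem disjointUnion_adj {ι : Type} [Fintype ι] (G : ι → WGraph.{u}) {i : ι} (x y : (G i).V) :
    (disjointUnion G).graph.Adj ⟨i, x⟩ ⟨i, y⟩ ↔ (G i).graph.Adj x y := by
  constructor
  · rintro ⟨j, a, b, h, hx, hy⟩
    obtain ⟨rfl, hx⟩ := Sigma.mk.inj hx
    obtain ⟨_, hy⟩ := Sigma.mk.inj hy
    rw [eq_of_heq hx, eq_of_heq hy]; exact h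
  · intro h; exact ⟨i, x, y, h, rfl, rfl⟩

theorem disjointUnion_not_adj {ι : Type} [Fintype ι] (G : ι → WGraph.{u}) {i j : ι} (hij : i ≠ j)
    (x : (G i).V) (y : (G j).V) : ¬ (disjointUnion G).graph.Adj ⟨i, x⟩ ⟨j, y⟩ := by
  rintro ⟨k, a, b, h, hx, hy⟩
  exact hij ((Sigma.mk.inj hx).1.trans (Sigma.mk.inj hy).1.symm)

/-- A disjoint union indexed by `Option ι`. -/
def splitOption {ι : Type} [Fintype ι] (G : Option ι → WGraph.{u}) :
    Split (G none) (disjointUnion fun i => G (some i)) (disjointUnion G) where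
  e :=
    { toFun := Sum.elim (fun x => ⟨none, x⟩) fun x => ⟨some x.1, x.2⟩
      invFun := fun
        | ⟨none, x⟩ => Sum.inl x
        | ⟨some i, x⟩ => Sum.inr ⟨i, x⟩
      left_inv := by rintro (x | ⟨i, x⟩) <;> rfl
      right_inv := by rintro ⟨_ | i, x⟩ <;> rfl }
  weight_inl _ := rfl
  weight_inr _ := rfl
  adj_inl x y := disjointUnion_adj G x y
  adj_inr := by
    rintro ⟨i, x⟩ ⟨j, y⟩
    by_cases hij : i = j
    · subst hij
      exact (disjointUnion_adj G x y).trans (disjointUnion_adj (fun i => G (some i)) x y).symm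
    · exact iff_of_false (disjointUnion_not_adj G (by simpa using hij) x y)
        (disjointUnion_not_adj (fun i => G (some i)) hij x y)
  not_adj x y := disjointUnion_not_adj G (by simp) x y.2

/-- Reindexing a disjoint union. -/
def disjointUnionCongr {ι κ : Type} [Fintype ι] [Fintype κ] (e : ι ≃ κ) (G : κ → WGraph.{u}) :
    Iso (disjointUnion fun i => G (e i)) (disjointUnion G) where
  toIso :=
    { toEquiv := Equiv.sigmaCongrLeft (β := fun k => (G k).V) e
      map_rel_iff' := by
        rintro ⟨i, x⟩ ⟨j, y⟩
        by_cases hij : i = j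
        · subst hij
          exact (disjointUnion_adj G x y).trans (disjointUnion_adj (fun i => G (e i)) x y).symm
        · exact iff_of_false (disjointUnion_not_adj G (e.injective.ne hij) x y)
            (disjointUnion_not_adj (fun i => G (e i)) hij x y) }
  weight_eq _ := rfl

theorem csf_disjointUnion {ι : Type} [Fintype ι] (G : ι → WGraph.{u}) :
    (disjointUnion G).csf K = ∏ i, (G i).csf K := by
  revert G
  refine Fintype.induction_empty_option
    (P := fun ι _ => ∀ G : ι → WGraph.{u}, (disjointUnion G).csf K = ∏ i, (G i).csf K)
    ?_ ?_ ?_ ι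
  · intro α β _ e ih G
    let _ := Fintype.ofEquiv β e.symm
    rw [← csf_congr_iso (disjointUnionCongr e G), ih, e.prod_comp fun j => (G j).csf K]
  · intro G
    have : IsEmpty (disjointUnion G).V := ⟨fun x => x.1.elim⟩
    rw [csf_empty]; rfl
  · intro α _ ih G
    rw [(splitOption G).csf, ih, Fintype.prod_option]

theorem csf_compl_disjointUnion {ι : Type} [Fintype ι] (G : ι → WGraph.{u}) :
    toTilde K ((disjointUnion G).compl.csf K) = ∏ i, toTilde K ((G i).compl.csf K) := by
  revert G
  refine Fintype.induction_empty_option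
    (P := fun ι _ => ∀ G : ι → WGraph.{u},
      toTilde K ((disjointUnion G).compl.csf K) = ∏ i, toTilde K ((G i).compl.csf K)) ?_ ?_ ?_ ι
  · intro α β _ e ih G
    let _ := Fintype.ofEquiv β e.symm
    rw [← csf_compl_congr_iso (disjointUnionCongr e G), ih,
      e.prod_comp fun j => toTilde K ((G j).compl.csf K)]
  · intro G
    have : IsEmpty (disjointUnion G).compl.V := ⟨fun x => x.1.elim⟩
    rw [csf_empty, ← mtBasis_zero, ← tBasis_apply]; rfl
  · intro α _ ih G
    rw [(splitOption G).csf_compl, ih, Fintype.prod_option]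

theorem csf_ofPartition (G : ℕ+ → WGraph.{u}) (l : Multiset ℕ+) :
    (ofPartition G l).csf K = (l.map fun n => (G n).csf K).prod := by
  rw [ofPartition, csf_disjointUnion]
  conv_rhs => rw [← Multiset.map_univ l]
  rfl

theorem csf_compl_ofPartition (G : ℕ+ → WGraph.{u}) (l : Multiset ℕ+) :
    toTilde K ((ofPartition G l).compl.csf K) =
      (l.map fun n => toTilde K ((G n).compl.csf K)).prod := by
  rw [ofPartition, csf_compl_disjointUnion]
  conv_rhs => rw [← Multiset.map_univ l]
  rfl

end

end WGraph

/-! ### Deletion and contraction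

A labelling `f` of the vertices stands for the graph in which equally labelled vertices are
identified, and a list of pairs for its edges. -/

section Merge

variable {V : Type u} [Fintype V]

/-- Identify the labels of `x` and `y`. -/
def merge (f : V → ℕ) (x y : V) : V → ℕ := fun z => if f z = f y then f x else f z

/-- This makes `merge` a contraction. It serves with `h` a coloring, for deletion and contraction,
and with `h` a predicate, to carry connectedness over to the contracted graph. -/
theorem merge_eq_iff {f : V → ℕ} {x y : V} {α : Type*} (h : V → α) :
    (∀ a b, merge f x y a = merge f x y b → h a = h b) ↔
      (∀ a b, f a = f b → h a = h b) ∧ h x = h y := by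
  constructor
  · intro H
    refine ⟨fun a b hab => H a b (by simp only [merge, hab]), H x y ?_⟩
    simp only [merge, if_true]
    split_ifs <;> rfl
  · rintro ⟨h1, h2⟩ a b hab
    simp only [merge] at hab
    split_ifs at hab with ha hb hb
    · rw [h1 a y ha, h1 b y hb]
    · rw [h1 a y ha, ← h2, h1 x b hab]
    · rw [h1 b y hb, ← h2, h1 a x hab]
    · exact h1 a b hab

theorem card_image_merge {f : V → ℕ} {x y : V} (hxy : f x ≠ f y) :
    (Finset.univ.image (merge f x y)).card + 1 = (Finset.univ.image f).card := by
  have : Finset.univ.image (merge f x y) = (Finset.univ.image f).erase (f y) := by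
    ext i
    simp only [Finset.mem_image, Finset.mem_univ, true_and, Finset.mem_erase, merge]
    constructor
    · rintro ⟨a, rfl⟩
      split_ifs with h
      · exact ⟨hxy, x, rfl⟩
      · exact ⟨h, a, rfl⟩
    · rintro ⟨hi, a, rfl⟩
      exact ⟨a, if_neg hi⟩
  rw [this, Finset.card_erase_add_one]
  exact Finset.mem_image_of_mem _ (Finset.mem_univ _)

/-- The signed number of connected spanning subgraphs. -/
def connSum : List (V × V) → (V → ℕ) → ℤ
  | [], f => if (Finset.univ.image f).card = 1 then 1 else 0
  | e :: l, f => connSum l f - connSum l (merge f e.1 e.2)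

/-- Contracting an edge with differently labelled ends lowers the number of labels by one; this
change of sign cancels the minus sign of the recursion. If the ends carry the same label, deletion
and contraction coincide and the difference is zero. -/
theorem connSum_nonneg (l : List (V × V)) (f : V → ℕ) :
    0 ≤ (-1) ^ ((Finset.univ.image f).card + 1) * connSum l f := by
  induction l generalizing f with
  | nil =>
    simp only [connSum]
    split_ifs with h
    · simp [h]
    · simp
  | cons e l ih =>
    simp only [connSum]
    by_cases he : f e.1 = f e.2
    · have : merge f e.1 e.2 = f := by
        funext z
        simp only [merge, he]
        split_ifs with h
        · exact h.symm
        · rfl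
      rw [this, sub_self, mul_zero]
    · have h1 := ih f
      have h2 := ih (merge f e.1 e.2)
      rw [card_image_merge he] at h2
      rw [pow_succ] at h1 ⊢
      linarith

/-- Connectedness is phrased as: a predicate that is constant on labels and along edges is constant.
Loops have to be excluded, since a loop makes `connSum` vanish; repeated edges are allowed. Both
terms of the recursion contribute with nonnegative sign, so it suffices that one of them satisfies
the hypotheses again. -/
theorem connSum_pos [Nonempty V] (l : List (V × V)) (f : V → ℕ)
    (hconn : ∀ h : V → Prop, (∀ a b, f a = f b → h a = h b) → (∀ e ∈ l, h e.1 = h e.2) →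
      ∀ a b, h a = h b)
    (hl : ∀ e ∈ l, f e.1 ≠ f e.2) :
    0 < (-1) ^ ((Finset.univ.image f).card + 1) * connSum l f := by
  induction l generalizing f with
  | nil =>
    obtain ⟨v⟩ := ‹Nonempty V›
    have hv : Finset.univ.image f = {f v} := by
      ext i
      simp only [Finset.mem_image, Finset.mem_univ, true_and, Finset.mem_singleton]
      constructor
      · rintro ⟨a, rfl⟩
        have := hconn (fun z => f z = f v) (fun a b hab => by rw [hab]) (by simp) a v
        simpa using this
      · rintro rfl; exact ⟨v, rfl⟩
    simp [connSum, hv]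
  | cons e l ih =>
    have he : f e.1 ≠ f e.2 := hl e (by simp)
    have h1 := connSum_nonneg l f
    have h2 := connSum_nonneg l (merge f e.1 e.2)
    rw [card_image_merge he] at h2
    simp only [connSum]
    -- Either the graph stays connected without `e`, and the deletion contributes strictly, or `e`
    -- is a bridge and the contraction does.
    by_cases hc : ∀ h : V → Prop, (∀ a b, f a = f b → h a = h b) → (∀ e ∈ l, h e.1 = h e.2) →
      ∀ a b, h a = h b
    · have h3 := ih f hc fun e he => hl e (by simp [he])
      rw [pow_succ] at h3 ⊢
      linarith
    · have h3 := ih (merge f e.1 e.2) (fun h hf hh => by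
          rw [merge_eq_iff] at hf
          refine hconn h hf.1 ?_
          intro e' he'
          rcases List.mem_cons.mp he' with rfl | he'
          · exact hf.2
          · exact hh e' he') (fun e' he' hm => hc fun h hf hh => by
          -- An edge `e'` that becomes a loop under the contraction of `e` is parallel to `e`. It
          -- joins the same labels, so the graph would be connected without `e`, against the choice
          -- of the case.
          refine hconn h hf ?_
          intro e'' he''
          rcases List.mem_cons.mp he'' with rfl | he''
          · have hne := hl e' (by simp [he'])
            have h4 := hh e' he'
            simp only [merge] at hm
            split_ifs at hm with h5 h6 h6
            · exact absurd (h5.trans h6.symm) hne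
            · rw [← hf _ _ h5, h4, hf _ _ hm]
            · rw [← hf _ _ h6, ← h4, hf _ _ hm]
            · exact absurd hm hne
          · exact hh e'' he'')
      rw [card_image_merge he] at h3
      rw [pow_succ] at h1 ⊢
      linarith

end Merge

/-! ### The leading term of the chromatic symmetric function of a connected graph -/

namespace WGraph

section

variable {K : Type*} [Field K] [CharZero K]

/-- A single vertex. -/
def point (n : ℕ+) : WGraph.{0} where
  V := Unit
  graph := ⊥
  weight := fun _ => n

theorem csf_point (n : ℕ+) : (point n).csf K = psum K n := by
  refine Lambda.ext_co fun d => ?_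
  rw [co_csf, co_psum]
  have hm : ∀ c : (point n).V → ℕ, (point n).colorMon c = Finsupp.single (c ()) (n : ℕ) := by
    intro c
    exact Fintype.sum_unique (ι := Unit) fun v => Finsupp.single (c v) (n : ℕ)
  split_ifs with h
  · obtain ⟨i, rfl⟩ := exists_single_of_expType h
    have : Nat.card ((point n).PropCol (Finsupp.single i (n : ℕ))) = 1 := by
      rw [Nat.card_eq_one_iff_unique]
      refine ⟨⟨fun a b => Subtype.ext (funext fun _ => ?_)⟩,
        ⟨⟨fun _ => i, fun _ _ hxy => hxy.elim, hm _⟩⟩⟩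
      exact (Finsupp.single_left_inj n.ne_zero).mp
        (((hm a.1).symm.trans a.2.2).trans ((hm b.1).symm.trans b.2.2).symm)
    rw [this, Nat.cast_one]
  · have : IsEmpty ((point n).PropCol d) :=
      ⟨fun c => h (by rw [← c.2.2, hm, expType_single])⟩
    rw [Nat.card_of_isEmpty, Nat.cast_zero]

/-- The weight of the vertices labelled `i`. -/
def blockWeight (H : WGraph.{u}) (f : H.V → ℕ) (i : ℕ) : ℕ+ :=
  (∑ v with f v = i, (H.weight v : ℕ)).toPNat'

/-- `toPNat'` has the value `1` at `0`, so the label has to occur. -/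
theorem blockWeight_coe (H : WGraph.{u}) (f : H.V → ℕ) {i : ℕ} (hi : i ∈ Finset.univ.image f) :
    (H.blockWeight f i : ℕ) = ∑ v with f v = i, (H.weight v : ℕ) := by
  obtain ⟨v, _, hv⟩ := Finset.mem_image.mp hi
  have : 0 < ∑ v with f v = i, (H.weight v : ℕ) :=
    Finset.sum_pos (fun v _ => (H.weight v).pos) ⟨v, by simp [hv]⟩
  simp [blockWeight, this]

/-- Colorings that are constant on labels and proper on a list of edges. -/
def LabelCol (H : WGraph.{u}) (l : List (H.V × H.V)) (f : H.V → ℕ) (d : ℕ →₀ ℕ) : Type u :=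
  {c : H.V → ℕ // ((∀ x y, f x = f y → c x = c y) ∧ ∀ e ∈ l, c e.1 ≠ c e.2) ∧ H.colorMon c = d}

instance (H : WGraph.{u}) (l : List (H.V × H.V)) (f : H.V → ℕ) (d : ℕ →₀ ℕ) :
    Finite (H.LabelCol l f d) := by
  let H' : WGraph.{u} := ⟨H.V, ⊥, H.weight⟩
  exact Finite.of_injective (β := H'.PropCol d)
    (fun c => ⟨c.1, fun _ _ h => h.elim, c.2.2⟩)
    fun a b hab => Subtype.ext (congrArg (fun c : H'.PropCol d => c.1) hab)

/-- The generating function of the colorings `LabelCol`, see `co_labelSum`. -/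
noncomputable def labelSum (K : Type*) [Field K] (H : WGraph.{u}) :
    List (H.V × H.V) → (H.V → ℕ) → Lambda K
  | [], f => ∏ i ∈ Finset.univ.image f, psum K (H.blockWeight f i)
  | e :: l, f => labelSum K H l f - labelSum K H l (merge f e.1 e.2)

/-- With no edges, identifying equally labelled vertices leaves one isolated point per label,
carrying the weight of its block. The product of power sums is the chromatic symmetric function of
this union of points. -/
theorem co_labelSum_nil (H : WGraph.{u}) (f : H.V → ℕ) (d : ℕ →₀ ℕ) :
    co d (labelSum K H [] f) = (Nat.card (H.LabelCol [] f d) : K) := by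
  let ι : Type := (Finset.univ.image f : Finset ℕ)
  let P : ι → WGraph.{0} := fun i => point (H.blockWeight f i.1)
  let F : H.V → ι := fun v => ⟨f v, Finset.mem_image_of_mem _ (Finset.mem_univ _)⟩
  have hF : Function.Surjective F := by
    rintro ⟨i, hi⟩
    obtain ⟨v, _, rfl⟩ := Finset.mem_image.mp hi
    exact ⟨v, rfl⟩
  have h1 : labelSum K H [] f = (disjointUnion P).csf K := by
    rw [csf_disjointUnion, labelSum, ← Finset.prod_coe_sort]
    exact Finset.prod_congr rfl fun i _ => (csf_point _).symm
  have hm : ∀ c : (disjointUnion P).V → ℕ,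
      (disjointUnion P).colorMon c = H.colorMon fun v => c ⟨F v, ()⟩ := by
    intro c
    classical
    have h2 : (disjointUnion P).colorMon c =
        ∑ i : ι, Finsupp.single (c ⟨i, ()⟩) (H.blockWeight f i.1 : ℕ) := by
      refine (Fintype.sum_sigma (α := fun i => (P i).V) _).trans ?_
      exact Finset.sum_congr rfl fun i _ => Fintype.sum_unique (ι := Unit) _
    rw [h2, colorMon, ← Finset.sum_fiberwise (g := F)]
    refine Finset.sum_congr rfl fun i _ => ?_
    rw [blockWeight_coe H f i.2, ← Finsupp.singleAddHom_apply, map_sum]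
    have h3 : ∀ v, F v = i ↔ f v = i.1 := fun v => Subtype.ext_iff
    simp only [h3]
    refine Finset.sum_congr rfl fun v hv => ?_
    rw [← (h3 v).mpr (Finset.mem_filter.mp hv).2]
    rfl
  rw [h1, co_csf]
  congr 1
  refine Nat.card_congr (Equiv.ofBijective
    (fun c => ⟨fun v => c.1 ⟨F v, ()⟩, ⟨fun x y hxy => ?_, by simp⟩, by rw [← hm]; exact c.2.2⟩)
    ⟨?_, ?_⟩)
  · have : F x = F y := Subtype.ext hxy
    exact congrArg (fun i => c.1 ⟨i, ()⟩) this
  · intro a b hab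
    apply Subtype.ext
    funext ⟨i, x⟩
    obtain ⟨v, rfl⟩ := hF i
    exact congrFun (congrArg Subtype.val hab) v
  · rintro ⟨c, ⟨hc, _⟩, hcd⟩
    have hcF : ∀ v, c (Function.surjInv hF (F v)) = c v := fun v =>
      hc _ _ (congrArg Subtype.val (Function.surjInv_eq hF (F v)))
    refine ⟨⟨fun z => c (Function.surjInv hF z.1), ?_, ?_⟩, ?_⟩
    · rintro x y ⟨i, a, b, h, _, _⟩
      exact h.elim
    · rw [hm]; simpa only [hcF] using hcd
    · exact Subtype.ext (funext hcF)

/-- Deletion and contraction: among the colorings proper on `l`, those with different colors at the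
ends of `e` are proper on `e :: l`, and the others are the colorings compatible with the merged
labelling. -/
theorem co_labelSum (H : WGraph.{u}) (l : List (H.V × H.V)) (f : H.V → ℕ) (d : ℕ →₀ ℕ) :
    co d (labelSum K H l f) = (Nat.card (H.LabelCol l f d) : K) := by
  induction l generalizing f with
  | nil => exact co_labelSum_nil H f d
  | cons e l ih =>
    rw [labelSum, map_sub, ih, ih, sub_eq_iff_eq_add, ← Nat.cast_add]
    congr 1
    rw [← Nat.card_sum]
    classical
    refine Nat.card_congr ((Equiv.sumCompl fun c : H.LabelCol l f d =>
      c.1 e.1 ≠ c.1 e.2).symm.trans (Equiv.sumCongr ?_ ?_))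
    · exact
        { toFun := fun c => ⟨c.1.1, ⟨c.1.2.1.1, List.forall_mem_cons.mpr ⟨c.2, c.1.2.1.2⟩⟩, c.1.2.2⟩
          invFun := fun c => ⟨⟨c.1, ⟨c.2.1.1, (List.forall_mem_cons.mp c.2.1.2).2⟩, c.2.2⟩,
            (List.forall_mem_cons.mp c.2.1.2).1⟩
          left_inv := fun _ => rfl
          right_inv := fun _ => rfl }
    · exact
        { toFun := fun c => ⟨c.1.1, ⟨(merge_eq_iff c.1.1).mpr ⟨c.1.2.1.1, not_not.mp c.2⟩,
            c.1.2.1.2⟩, c.1.2.2⟩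
          invFun := fun c => ⟨⟨c.1, ⟨((merge_eq_iff c.1).mp c.2.1.1).1, c.2.1.2⟩, c.2.2⟩,
            not_not.mpr ((merge_eq_iff c.1).mp c.2.1.1).2⟩
          left_inv := fun _ => rfl
          right_inv := fun _ => rfl }

/-- `labelSum` and `connSum` obey the same recursion, so only the empty list matters. There a single
block gives `p_N`, and several blocks give a product of power sums of smaller index. -/
theorem labelSum_leading (H : WGraph.{u}) [Nonempty H.V] {N : ℕ+} (hN : H.totalWeight = N)
    (l : List (H.V × H.V)) (f : H.V → ℕ) :
    labelSum K H l f - (connSum l f : K) • psum K N ∈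
      Algebra.adjoin K (psum K '' Set.Iio N) := by
  induction l generalizing f with
  | nil =>
    simp only [labelSum, connSum]
    split_ifs with h
    · obtain ⟨i, hi⟩ := Finset.card_eq_one.mp h
      have hiN : H.blockWeight f i = N := by
        apply PNat.eq
        rw [blockWeight_coe H f (by simp [hi]), ← hN, totalWeight]
        rw [Finset.filter_true_of_mem]
        intro v _
        have := Finset.mem_image_of_mem f (Finset.mem_univ v)
        rwa [hi, Finset.mem_singleton] at this
      simp [hi, hiN]
    · rw [Int.cast_zero, zero_smul, sub_zero]
      refine Subalgebra.prod_mem _ fun i hi => Algebra.subset_adjoin ⟨_, ?_, rfl⟩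
      rw [Set.mem_Iio, ← PNat.coe_lt_coe, blockWeight_coe H f hi, ← hN, totalWeight]
      -- A second label takes away positive weight, so each block weighs less than `N`.
      have h2 : 1 < (Finset.univ.image f).card := by
        have := Finset.card_pos.mpr ⟨i, hi⟩
        omega
      obtain ⟨j, hj, hij⟩ := Finset.exists_mem_ne h2 i
      obtain ⟨v, _, rfl⟩ := Finset.mem_image.mp hj
      refine Finset.sum_lt_sum_of_subset (Finset.filter_subset _ _) (Finset.mem_univ v) ?_
        (H.weight v).pos (fun _ _ _ => Nat.zero_le _)
      simp [hij]
  | cons e l ih =>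
    have := Subalgebra.sub_mem _ (ih f) (ih (merge f e.1 e.2))
    convert! this using 1
    simp only [labelSum, connSum, Int.cast_sub, sub_smul]
    abel

/-- The leading term of the chromatic symmetric function of a connected graph. -/
theorem csf_leading (H : WGraph.{u}) (hH : H.graph.Connected) {N : ℕ+} (hN : H.totalWeight = N) :
    ∃ a : K, a ≠ 0 ∧ H.csf K - a • psum K N ∈ Algebra.adjoin K (psum K '' Set.Iio N) := by
  classical
  have := hH.nonempty
  -- An injective labelling, which identifies no vertices. The list `l` contains each edge in both
  -- orientations; this only repeats conditions on the colorings, and `connSum_pos` tolerates it.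
  let f : H.V → ℕ := fun v => Fintype.equivFin H.V v
  have hf : Function.Injective f := Fin.val_injective.comp (Fintype.equivFin H.V).injective
  let l : List (H.V × H.V) := (Finset.univ.filter fun e => H.graph.Adj e.1 e.2).toList
  have hl : ∀ e, e ∈ l ↔ H.graph.Adj e.1 e.2 := by simp [l]
  have h1 : H.csf K = labelSum K H l f := by
    refine Lambda.ext_co fun d => ?_
    rw [co_csf, co_labelSum]
    congr 1
    refine Nat.card_congr (Equiv.subtypeEquivRight fun c => and_congr_left fun _ => ?_)
    constructor
    · exact fun h => ⟨fun x y hxy => congrArg c (hf hxy), fun e he => h _ _ ((hl e).mp he)⟩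
    · exact fun h x y hxy => h.2 (x, y) ((hl _).mpr hxy)
  refine ⟨connSum l f, ?_, h1 ▸ labelSum_leading H hN l f⟩
  have hpos := connSum_pos l f (fun h _ hh a b => by
      obtain ⟨p⟩ := hH.preconnected a b
      induction p with
      | nil => rfl
      | cons hadj _ ih => exact (hh (_, _) ((hl _).mpr hadj)).trans ih)
    (fun e he => hf.ne ((hl e).mp he).ne)
  intro h0
  rw [Int.cast_eq_zero] at h0
  rw [h0, mul_zero] at hpos
  exact lt_irrefl _ hpos

end

end WGraph

/-! ### The coproduct of a chromatic symmetric function -/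

theorem joinMon_single_left (i n : ℕ) :
    joinMon (Finsupp.single i n, 0) = Finsupp.single (Equiv.natSumNatEquivNat (Sum.inl i)) n := by
  have h : Finsupp.sumFinsuppAddEquivProdFinsupp.symm (Finsupp.single i n, (0 : ℕ →₀ ℕ)) =
      Finsupp.single (Sum.inl i) n := by
    rw [AddEquiv.symm_apply_eq]
    ext j
    · simp [Finsupp.single_apply]
    · simp
  change Finsupp.domCongr Equiv.natSumNatEquivNat _ = _
  erw [h]
  simp

theorem joinMon_single_right (i n : ℕ) :
    joinMon (0, Finsupp.single i n) = Finsupp.single (Equiv.natSumNatEquivNat (Sum.inr i)) n := by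
  have h : Finsupp.sumFinsuppAddEquivProdFinsupp.symm ((0 : ℕ →₀ ℕ), Finsupp.single i n) =
      Finsupp.single (Sum.inr i) n := by
    rw [AddEquiv.symm_apply_eq]
    ext j
    · simp
    · simp [Finsupp.single_apply]
  change Finsupp.domCongr Equiv.natSumNatEquivNat _ = _
  erw [h]
  simp

namespace WGraph

section

variable {K : Type*} [Field K] [CharZero K]

theorem colorMon_induce (H : WGraph.{u}) (S : Set H.V) (a : S → ℕ) (b : (Sᶜ : Set H.V) → ℕ)
    (c : H.V → ℕ) (ha : ∀ v : S, c v = Equiv.natSumNatEquivNat (Sum.inl (a v)))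
    (hb : ∀ v : (Sᶜ : Set H.V), c v = Equiv.natSumNatEquivNat (Sum.inr (b v))) :
    H.colorMon c = joinMon ((H.induce S).colorMon a, (H.induce Sᶜ).colorMon b) := by
  classical
  let _ : Fintype S := Fintype.ofFinite S
  let _ : Fintype (Sᶜ : Set H.V) := Fintype.ofFinite _
  have h1 : joinMon ((H.induce S).colorMon a, 0) =
      ∑ v : S, Finsupp.single (c v) (H.weight v : ℕ) := by
    change (joinMon.toAddMonoidHom.comp (AddMonoidHom.inl _ _)) (∑ v : S, Finsupp.single (a v) _) = _
    rw [map_sum]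
    refine Finset.sum_congr rfl fun v _ => ?_
    rw [ha]
    exact joinMon_single_left _ _
  have h2 : joinMon (0, (H.induce Sᶜ).colorMon b) =
      ∑ v : (Sᶜ : Set H.V), Finsupp.single (c v) (H.weight v : ℕ) := by
    change (joinMon.toAddMonoidHom.comp (AddMonoidHom.inr _ _))
      (∑ v : (Sᶜ : Set H.V), Finsupp.single (b v) _) = _
    rw [map_sum]
    refine Finset.sum_congr rfl fun v _ => ?_
    rw [hb]
    exact joinMon_single_right _ _
  rw [← add_zero ((H.induce S).colorMon a), ← zero_add ((H.induce Sᶜ).colorMon b),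
    ← Prod.mk_add_mk, map_add, h1, h2, colorMon, ← (Equiv.Set.sumCompl S).sum_comp,
    Fintype.sum_sum_type]
  rfl

/-- The vertices colored from the first set of variables. -/
def leftSet (H : WGraph.{u}) (c : H.V → ℕ) : Finset H.V :=
  Finset.univ.filter fun v => (Equiv.natSumNatEquivNat.symm (c v)).isLeft

theorem eq_inl_of_isLeft {n : ℕ} (h : (Equiv.natSumNatEquivNat.symm n).isLeft) :
    n = Equiv.natSumNatEquivNat
      (Sum.inl (Sum.elim id (fun _ => 0) (Equiv.natSumNatEquivNat.symm n))) := by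
  obtain ⟨i, hi⟩ := Sum.isLeft_iff.mp h
  rw [hi, Sum.elim_inl, id, ← hi, Equiv.apply_symm_apply]

theorem eq_inr_of_not_isLeft {n : ℕ} (h : ¬ (Equiv.natSumNatEquivNat.symm n).isLeft) :
    n = Equiv.natSumNatEquivNat
      (Sum.inr (Sum.elim (fun _ => 0) id (Equiv.natSumNatEquivNat.symm n))) := by
  obtain ⟨i, hi⟩ := Sum.isRight_iff.mp (Sum.not_isLeft.mp (by exact h))
  rw [hi, Sum.elim_inr, id, ← hi, Equiv.apply_symm_apply]

theorem mem_leftSet (H : WGraph.{u}) (c : H.V → ℕ) (v : H.V) :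
    v ∈ H.leftSet c ↔ (Equiv.natSumNatEquivNat.symm (c v)).isLeft := by
  simp [leftSet]

/-- The bijection `natSumNatEquivNat` divides the colors into two disjoint palettes. Once the
vertices using the first palette are fixed to be `S`, edges between `S` and its complement are never
violated, so the colorings of the two induced subgraphs are independent. -/
theorem card_leftSet_fiber (H : WGraph.{u}) (S : Finset H.V) (d e : ℕ →₀ ℕ) :
    Nat.card {c : H.PropCol (joinMon (d, e)) // H.leftSet c.1 = S} =
      Nat.card ((H.induce S).PropCol d) * Nat.card ((H.induce (S : Set H.V)ᶜ).PropCol e) := by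
  classical
  rw [← Nat.card_prod]
  -- The default color `0` in `A` and `B` is never reached when `leftSet` is `S`, as `hA` and `hB`
  -- show.
  let A : (H.V → ℕ) → ↥(S : Set H.V) → ℕ := fun c v =>
    Sum.elim id (fun _ => 0) (Equiv.natSumNatEquivNat.symm (c v))
  let B : (H.V → ℕ) → ↥((S : Set H.V)ᶜ : Set H.V) → ℕ := fun c v =>
    Sum.elim (fun _ => 0) id (Equiv.natSumNatEquivNat.symm (c v))
  have hA : ∀ c, H.leftSet c = S → ∀ v : (S : Set H.V), c v =
      Equiv.natSumNatEquivNat (Sum.inl (A c v)) := fun c hc v =>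
    eq_inl_of_isLeft ((mem_leftSet H c v).mp (by rw [hc]; exact v.2))
  have hB : ∀ c, H.leftSet c = S → ∀ v : ((S : Set H.V)ᶜ : Set H.V), c v =
      Equiv.natSumNatEquivNat (Sum.inr (B c v)) := fun c hc v =>
    eq_inr_of_not_isLeft fun h => v.2 (by
      have := (mem_leftSet H c v).mpr h
      rwa [hc] at this)
  have hmon : ∀ c, H.leftSet c = S → H.colorMon c = joinMon (d, e) →
      (H.induce S).colorMon (A c) = d ∧ (H.induce (S : Set H.V)ᶜ).colorMon (B c) = e := by
    intro c hc h
    rw [colorMon_induce H S (A c) (B c) c (hA c hc) (hB c hc)] at h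
    exact Prod.ext_iff.mp (joinMon.injective h)
  let C : (↥(S : Set H.V) → ℕ) → (↥((S : Set H.V)ᶜ : Set H.V) → ℕ) → H.V → ℕ := fun a b v =>
    Equiv.natSumNatEquivNat (if h : v ∈ S then Sum.inl (a ⟨v, h⟩) else Sum.inr (b ⟨v, h⟩))
  have hCl : ∀ a b (v : (S : Set H.V)), C a b v = Equiv.natSumNatEquivNat (Sum.inl (a v)) :=
    fun a b v => by
      have : (v : H.V) ∈ S := v.2
      simp only [C, this, dite_true]
  have hCr : ∀ a b (v : ((S : Set H.V)ᶜ : Set H.V)),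
      C a b v = Equiv.natSumNatEquivNat (Sum.inr (b v)) :=
    fun a b v => by
      have : (v : H.V) ∉ S := v.2
      simp only [C, this, dite_false]
  have hCS : ∀ a b, H.leftSet (C a b) = S := by
    intro a b
    ext v
    rw [mem_leftSet]
    by_cases hv : v ∈ S
    · simp [C, hv]
    · simp [C, hv]
  refine Nat.card_congr
    { toFun := fun c => (⟨A c.1.1, fun x y hxy h => ?_, (hmon c.1.1 c.2 c.1.2.2).1⟩,
        ⟨B c.1.1, fun x y hxy h => ?_, (hmon c.1.1 c.2 c.1.2.2).2⟩)
      invFun := fun q => ⟨⟨C q.1.1 q.2.1, fun x y hxy => ?_, ?_⟩, hCS _ _⟩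
      left_inv := fun c => ?_
      right_inv := fun q => ?_ }
  · exact c.1.2.1 x.1 y.1 hxy (by rw [hA _ c.2 x, hA _ c.2 y, h])
  · exact c.1.2.1 x.1 y.1 hxy (by rw [hB _ c.2 x, hB _ c.2 y, h])
  · by_cases hx : x ∈ S <;> by_cases hy : y ∈ S <;> simp only [C, hx, hy, dite_true, dite_false,
      (Equiv.injective _).ne_iff, ne_eq, Sum.inl.injEq, Sum.inr.injEq, reduceCtorEq,
      not_false_eq_true]
    · exact q.1.2.1 ⟨x, hx⟩ ⟨y, hy⟩ hxy
    · exact q.2.2.1 ⟨x, hx⟩ ⟨y, hy⟩ hxy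
  · rw [colorMon_induce H S q.1.1 q.2.1 _ (hCl _ _) (hCr _ _), q.1.2.2, q.2.2.2]
  · refine Subtype.ext (Subtype.ext (funext fun v => ?_))
    by_cases hv : v ∈ S
    · exact (hCl (A c.1.1) (B c.1.1) ⟨v, hv⟩).trans (hA _ c.2 ⟨v, hv⟩).symm
    · exact (hCr (A c.1.1) (B c.1.1) ⟨v, hv⟩).trans (hB _ c.2 ⟨v, hv⟩).symm
  · refine Prod.ext (Subtype.ext (funext fun v => ?_)) (Subtype.ext (funext fun v => ?_))
    · change Sum.elim id _ (Equiv.natSumNatEquivNat.symm (C q.1.1 q.2.1 v.1)) = _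
      erw [hCl q.1.1 q.2.1 v]
      simp
    · change Sum.elim _ id (Equiv.natSumNatEquivNat.symm (C q.1.1 q.2.1 v.1)) = _
      erw [hCr q.1.1 q.2.1 v]
      simp

/-- Applying `Δ` amounts to using two sets of variables, that is, two palettes. The colorings are
sorted by the set `S` of vertices colored from the first one. -/
theorem coprod_csf (H : WGraph.{u}) : coprod K (H.csf K) =
    ∑ S : Finset H.V, (H.induce S).csf K ⊗ₜ[K] (H.induce (S : Set H.V)ᶜ).csf K := by
  refine coco_sep fun d e => ?_
  rw [coco_coprod _ (expType_joinMon (d, e)), co_csf, map_sum,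
    ← Nat.card_congr (Equiv.sigmaFiberEquiv fun c : H.PropCol (joinMon (d, e)) => H.leftSet c.1),
    Nat.card_sigma, Nat.cast_sum]
  refine Finset.sum_congr rfl fun S _ => ?_
  rw [card_leftSet_fiber, Nat.cast_mul, coco_tmul, co_csf, co_csf]

end

end WGraph

/-! ### Polynomial generators, homogeneous components and primitive elements -/

/-- Inverting a unitriangular (up to units) substitution of generators. -/
theorem exists_preimage_of_triangular {K A B : Type*} [Field K] [CommRing A] [CommRing B]
    [Algebra K A] [Algebra K B] (E : A →ₐ[K] B) (g : ℕ+ → A) (h : ℕ+ → B) (a : ℕ+ → K)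
    (ha : ∀ n, a n ≠ 0)
    (hE : ∀ n, E (g n) - a n • h n ∈ Algebra.adjoin K (h '' Set.Iio n)) (n : ℕ+) :
    ∃ y, E y = h n ∧ y - (a n)⁻¹ • g n ∈ Algebra.adjoin K (g '' Set.Iio n) := by
  induction n using PNat.strongInductionOn with
  | _ n ih =>
    have hmono : ∀ k < n, Algebra.adjoin K (g '' Set.Iio k) ≤ Algebra.adjoin K (g '' Set.Iio n) :=
      fun k hk => Algebra.adjoin_mono (Set.image_mono (Set.Iio_subset_Iio hk.le))
    -- By induction every `h k` with `k < n` is the image of a polynomial in the `g j` with `j < n`.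
    -- Hence the error `E (g n) - a n • h n` is the image of such a polynomial `r`, and `g n - r`
    -- maps to `a n • h n`.
    have hle : Algebra.adjoin K (h '' Set.Iio n) ≤ (Algebra.adjoin K (g '' Set.Iio n)).map E := by
      rw [Algebra.adjoin_le_iff]
      rintro _ ⟨k, hk, rfl⟩
      obtain ⟨y, hy, hy'⟩ := ih k hk
      refine ⟨y, ?_, hy⟩
      have h1 : (a k)⁻¹ • g k ∈ Algebra.adjoin K (g '' Set.Iio n) :=
        Subalgebra.smul_mem _ (Algebra.subset_adjoin (Set.mem_image_of_mem g hk)) _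
      have := Subalgebra.add_mem _ (hmono k hk hy') h1
      rwa [sub_add_cancel] at this
    obtain ⟨r, hr, hr'⟩ := hle (hE n)
    refine ⟨(a n)⁻¹ • (g n - r), ?_, ?_⟩
    · have h2 : E r = E (g n) - a n • h n := hr'
      rw [map_smul, map_sub, h2, sub_sub_cancel, smul_smul, inv_mul_cancel₀ (ha n), one_smul]
    · rw [smul_sub, sub_sub_cancel_left]
      exact Subalgebra.neg_mem _ (Subalgebra.smul_mem _ hr _)

section

variable {K : Type*} [Field K] [CharZero K]

/-- A family with leading terms `a_n p_n`, `a_n ≠ 0`, is a polynomial basis of `Λ`. -/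
theorem tildeLift_bijective (f : ℕ+ → Lambda K) (a : ℕ+ → K) (ha : ∀ n, a n ≠ 0)
    (hf : ∀ n, f n - a n • psum K n ∈ Algebra.adjoin K (psum K '' Set.Iio n)) :
    Function.Bijective (tildeLift (K := K) f) := by
  have hg : ∀ n, tildeLift (K := K) f (tBasis K {n}) = f n := fun n => by
    rw [tildeLift_basis]; simp
  choose y hy hy' using exists_preimage_of_triangular (tildeLift (K := K) f)
    (fun n => tBasis K {n}) (psum K) a ha (fun n => by rw [hg]; exact hf n)
  have hσ : ∀ n, tildeLift (K := K) y (tBasis K {n}) = y n := fun n => by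
    rw [tildeLift_basis]; simp
  -- The lift of `f` after the lift of `y` is an isomorphism. That already makes the lift of `f`
  -- surjective; its injectivity follows once the lift of `y` is surjective.
  have hcomp : (tildeLift (K := K) f).comp (tildeLift (K := K) y) = tildeToLambda K :=
    AlgHom.ext_of_adjoin_eq_top tilde_adjoin (by
      rintro _ ⟨n, rfl⟩
      rw [AlgHom.comp_apply, hσ, hy, tildeToLambda, tildeLift_basis]
      simp)
  have hσs : Function.Surjective (tildeLift (K := K) y) := by
    rw [← AlgHom.range_eq_top, eq_top_iff, ← tilde_adjoin, Algebra.adjoin_le_iff]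
    rintro _ ⟨n, rfl⟩
    -- The elements `y n` are again triangular in the generators `m̃_n`, with leading coefficients
    -- `(a n)⁻¹`, so the inversion applies a second time.
    obtain ⟨z, hz, _⟩ := exists_preimage_of_triangular (tildeLift (K := K) y)
      (fun n => tBasis K {n}) (fun n => tBasis K {n}) (fun n => (a n)⁻¹)
      (fun n => inv_ne_zero (ha n)) (fun n => by rw [hσ]; exact hy' n) n
    exact ⟨z, hz⟩
  have hc : ∀ x, tildeLift (K := K) f (tildeLift (K := K) y x) = tildeToLambda K x :=
    fun x => DFunLike.congr_fun hcomp x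
  constructor
  · rw [injective_iff_map_eq_zero]
    intro x hx
    obtain ⟨z, rfl⟩ := hσs x
    rw [hc] at hx
    rw [(injective_iff_map_eq_zero _).mp tildeToLambda_bijective.1 z hx, map_zero]
  · intro x
    obtain ⟨z, rfl⟩ := tildeToLambda_bijective.2 x
    exact ⟨_, hc z⟩

/-- The projection to the homogeneous component of degree `n`. -/
noncomputable def homogProj (K : Type*) [Field K] [CharZero K] (n : ℕ) : Lambda K →ₗ[K] Lambda K :=
  (mtBasis K).constr K fun l =>
    if (l.map fun n : ℕ+ => (n : ℕ)).sum = n then mtBasis K l else 0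

theorem co_homogProj (n : ℕ) (f : Lambda K) (d : ℕ →₀ ℕ) :
    co d (homogProj K n f) = if d.degree = n then co d f else 0 := by
  have h : co d ∘ₗ homogProj K n = (if d.degree = n then 1 else 0 : K) • co d := by
    refine (mtBasis K).ext fun l => ?_
    rw [LinearMap.comp_apply, homogProj, Module.Basis.constr_basis, LinearMap.smul_apply,
      co_mtBasis]
    by_cases hd : expType d = l
    · subst hd
      rw [sum_expType, if_pos rfl]
      split_ifs with h
      · rw [co_mtBasis, if_pos rfl, one_smul]
      · rw [map_zero, zero_smul]
    · rw [if_neg hd, smul_zero]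
      split_ifs
      · rw [co_mtBasis, if_neg hd]
      · rw [map_zero]
  have := LinearMap.congr_fun h f
  rw [LinearMap.comp_apply] at this
  rw [this, LinearMap.smul_apply]
  split_ifs <;> simp

theorem homogProj_of_mem {n : ℕ} {f : Lambda K} (hf : f ∈ Lambda.homog K n) :
    homogProj K n f = f := by
  refine Lambda.ext_co fun d => ?_
  rw [co_homogProj]
  split_ifs with h
  · rfl
  · exact (hf d h).symm

theorem homogProj_of_ne {n m : ℕ} (hnm : n ≠ m) {f : Lambda K} (hf : f ∈ Lambda.homog K m) :
    homogProj K n f = 0 := by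
  refine Lambda.ext_co fun d => ?_
  rw [co_homogProj, map_zero]
  split_ifs with h
  · exact hf d (h ▸ hnm)
  · rfl

theorem psum_homog (n : ℕ+) : psum K n ∈ Lambda.homog K n := by
  intro d hd
  change co d (psum K n) = 0
  rw [co_psum, if_neg]
  intro h
  apply hd
  rw [← sum_expType, h]
  simp

theorem co_one_of_ne {d : ℕ →₀ ℕ} (hd : expType d ≠ 0) : co d (1 : Lambda K) = 0 := by
  rw [← mtBasis_zero, co_mtBasis, if_neg hd]

/-- A primitive element of degree `n` is a multiple of `m̃_n`. -/
theorem eq_smul_of_primitive {n : ℕ+} {x : Lambda K} (hx : coprod K x = x ⊗ₜ 1 + 1 ⊗ₜ x)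
    (hn : x ∈ Lambda.homog K n) :
    x = co (Finsupp.single 0 (n : ℕ)) x • mtBasis K {n} := by
  refine Lambda.ext_co fun d => ?_
  rw [map_smul, co_mtBasis, multFact_singleton]
  split_ifs with h
  · rw [Nat.cast_one, smul_eq_mul, mul_one]
    exact co_eq_of_expType x (h.trans (expType_single 0 n).symm)
  · rw [smul_zero]
    by_cases hd : d.degree = n
    · obtain hz | ⟨m, hm⟩ := (expType d).empty_or_exists_mem
      · exfalso
        have := sum_expType d
        rw [hz, hd] at this
        exact n.ne_zero (by simpa using this.symm)
      · obtain ⟨l, hl⟩ := Multiset.exists_cons_of_mem hm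
        have hl0 : l ≠ 0 := by
          rintro rfl
          have := sum_expType d
          rw [hl, hd] at this
          apply h
          rw [hl]
          have h1 : m = n := PNat.eq (by simpa using this)
          rw [h1]; rfl
        have h1 : expType d = expType (rep {m}) + expType (rep l) := by
          rw [expType_rep, expType_rep, hl, Multiset.singleton_add]
        rw [← coco_coprod x h1, hx, map_add, coco_tmul, coco_tmul,
          co_one_of_ne (by rwa [expType_rep]),
          co_one_of_ne (by rw [expType_rep]; exact Multiset.singleton_ne_zero m),
          mul_zero, zero_mul, add_zero]
    · exact hn d hd

/-- The coefficient of `m̃_n` vanishes on polynomials in `m̃_k`, `k < n`. -/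
theorem co_adjoin_lt {n : ℕ+} {x : LambdaTilde K}
    (hx : x ∈ Algebra.adjoin K ((fun k : ℕ+ => tBasis K {k}) '' Set.Iio n)) :
    co (Finsupp.single 0 (n : ℕ)) ((toTilde K).symm x) = 0 := by
  -- `τ` kills the generators of index at least `n` and fixes those below. It is the identity on the
  -- given subalgebra, and nothing in its image involves `m̃_n`.
  let τ : LambdaTilde K →ₐ[K] LambdaTilde K := tildeLift fun k => if k < n then tBasis K {k} else 0
  have h1 : τ x = x := by
    have hle : Algebra.adjoin K ((fun k : ℕ+ => tBasis K {k}) '' Set.Iio n) ≤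
        AlgHom.equalizer τ (AlgHom.id K _) := by
      rw [Algebra.adjoin_le_iff]
      rintro _ ⟨k, hk, rfl⟩
      change τ (tBasis K {k}) = tBasis K {k}
      rw [tildeLift_basis, Multiset.map_singleton, Multiset.prod_singleton]
      exact if_pos hk
    exact hle hx
  have h2 : co (Finsupp.single 0 (n : ℕ)) ∘ₗ (toTilde K).symm.toLinearMap ∘ₗ τ.toLinearMap = 0 := by
    refine (tBasis K).ext fun l => ?_
    change co (Finsupp.single 0 (n : ℕ)) ((toTilde K).symm (τ (tBasis K l))) = 0
    rw [tildeLift_basis]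
    by_cases hl : ∀ k ∈ l, k < n
    · rw [Multiset.map_congr rfl fun k hk => if_pos (hl k hk), ← tBasis_eq_prod, tBasis_apply,
        LinearEquiv.symm_apply_apply, co_mtBasis, expType_single, if_neg]
      rintro rfl
      exact lt_irrefl n (hl n (Multiset.mem_singleton_self n))
    · push Not at hl
      obtain ⟨k, hk, hkn⟩ := hl
      rw [Multiset.prod_eq_zero, map_zero, map_zero]
      exact Multiset.mem_map.mpr ⟨k, hk, if_neg (not_lt.mpr hkn)⟩
  have := LinearMap.congr_fun h2 x
  change co (Finsupp.single 0 (n : ℕ)) ((toTilde K).symm (τ x)) = 0 at this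
  rwa [h1] at this

theorem symm_one_tilde : (toTilde K).symm 1 = 1 := by
  rw [← tBasis_zero, tBasis_apply, LinearEquiv.symm_apply_apply, mtBasis_zero]

end

/-! ### The morphism `φ` and induced subgraphs -/

namespace WGraph

section

variable {K : Type*} [Field K] [CharZero K]

/-- An induced subgraph without edges between `C` and `S \ C`. -/
noncomputable def splitInduce (G : WGraph.{u}) {C S : Set G.V} (hCS : C ⊆ S)
    (h : ∀ x ∈ C, ∀ y ∈ S \ C, ¬ G.graph.Adj x y) :
    Split (G.induce C) (G.induce (S \ C)) (G.induce S) :=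
  letI := Classical.decPred (· ∈ C)
  { e := Equiv.Set.sumDiffSubset hCS
    weight_inl := fun x => congrArg G.weight (congrArg Subtype.val (Equiv.Set.sumDiffSubset_apply_inl hCS x))
    weight_inr := fun x => congrArg G.weight (congrArg Subtype.val (Equiv.Set.sumDiffSubset_apply_inr hCS x))
    adj_inl := fun _ _ => Iff.rfl
    adj_inr := fun _ _ => Iff.rfl
    not_adj := fun x y => h x.1 x.2 y.1 y.2 }

/-- A maximal subset of `S` inducing a connected subgraph is a component: a neighbor in `S` outside
it could be added. Components taken in this form are induced subgraphs of `G` itself, to which the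
hypothesis on the family applies directly. -/
theorem exists_component (G : WGraph.{u}) {S : Set G.V} (hS : S.Nonempty) :
    ∃ C ⊆ S, (G.graph.induce C).Connected ∧ ∀ x ∈ C, ∀ y ∈ S \ C, ¬ G.graph.Adj x y := by
  obtain ⟨v, hv⟩ := hS
  have hfin : {C : Set G.V | C ⊆ S ∧ (G.graph.induce C).Connected}.Finite := Set.toFinite _
  obtain ⟨C, hC⟩ := hfin.exists_maximal ⟨{v}, by simpa using hv, by
    have : Subsingleton ({v} : Set G.V) := by simp
    have : Nonempty ({v} : Set G.V) := ⟨⟨v, rfl⟩⟩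
    exact SimpleGraph.Connected.mk SimpleGraph.Preconnected.of_subsingleton⟩
  refine ⟨C, hC.prop.1, hC.prop.2, fun x hx y hy hxy => hy.2 ?_⟩
  have h1 : (G.graph.induce (C ∪ {x, y})).Connected :=
    SimpleGraph.induce_union_connected hC.prop.2.preconnected
      (SimpleGraph.induce_pair_connected_of_adj hxy).preconnected ⟨x, hx, by simp⟩
  refine hC.le_of_ge ⟨?_, h1⟩ Set.subset_union_left (Or.inr (by simp))
  rintro z (hz | rfl | rfl)
  · exact hC.prop.1 hz
  · exact hC.prop.1 hx
  · exact hy.1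

/-- Splitting off a component `C` multiplies both sides by a factor, in the product of `Λ` and of
`Λ̃` respectively. The factor of `C` is known because `C` is isomorphic to some `G_i`, and the rest
has fewer vertices. -/
theorem map_csf_induce (G : ℕ+ → WGraph.{u})
    (hind : ∀ (n : ℕ+) (S : Set (G n).V), ((G n).induce S).graph.Connected →
      ∃ i : ℕ+, Nonempty (((G n).induce S).Iso (G i)))
    (φ : Lambda K →ₐ[K] LambdaTilde K)
    (hφ : ∀ n, φ ((G n).csf K) = toTilde K ((G n).compl.csf K)) (n : ℕ+) (S : Set (G n).V) :
    φ (((G n).induce S).csf K) = toTilde K (((G n).induce S).compl.csf K) := by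
  induction hk : S.ncard using Nat.strong_induction_on generalizing S with
  | _ k ih =>
    obtain rfl | hS := S.eq_empty_or_nonempty
    · have h1 : IsEmpty ((G n).induce ∅).V := inferInstanceAs (IsEmpty (∅ : Set (G n).V))
      have h2 : IsEmpty ((G n).induce ∅).compl.V := h1
      rw [csf_empty, csf_empty, map_one, ← mtBasis_zero, ← tBasis_apply, tBasis_zero]
    · obtain ⟨C, hCS, hC, hadj⟩ := (G n).exists_component hS
      have s := (G n).splitInduce hCS hadj
      obtain ⟨i, ⟨e⟩⟩ := hind n C hC
      have hlt : (S \ C).ncard < k := by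
        rw [← hk]
        have : C.Nonempty := Set.nonempty_coe_sort.mp hC.nonempty
        exact Set.ncard_lt_ncard (Set.sdiff_ssubset_left_iff.mpr
          (by rwa [Set.inter_eq_right.mpr hCS])) (Set.toFinite _)
      rw [s.csf, s.csf_compl, map_mul, ih _ hlt _ rfl, csf_congr_iso e, csf_compl_congr_iso e, hφ]

theorem csf_compl_induce (G : WGraph.{u}) (S : Set G.V) :
    (G.compl.induce S).csf K = (G.induce S).compl.csf K := by
  refine csf_congr (G := G.compl.induce S) (H := (G.induce S).compl) (Equiv.refl S)
    (fun _ => rfl) fun x y => ?_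
  change (x ≠ y ∧ ¬ G.graph.Adj x.1 y.1) ↔ (x.1 ≠ y.1 ∧ ¬ G.graph.Adj x.1 y.1)
  exact and_congr_left fun _ => not_congr Subtype.ext_iff

theorem coprod_csf_compl (G : WGraph.{u}) : coprod K (G.compl.csf K) =
    ∑ S : Finset G.V, (G.induce S).compl.csf K ⊗ₜ[K] (G.induce (S : Set G.V)ᶜ).compl.csf K :=
  (coprod_csf G.compl).trans (Finset.sum_congr rfl fun (S : Finset G.V) _ =>
    congrArg₂ (· ⊗ₜ[K] ·) (csf_compl_induce G S) (csf_compl_induce G (S : Set G.V)ᶜ))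

/-- Complementation of disjoint unions, as a morphism of bialgebras. -/
theorem exists_bialgHom (G : ℕ+ → WGraph.{u})
    (hweight : ∀ n : ℕ+, (G n).totalWeight = (n : ℕ))
    (hind : ∀ (n : ℕ+) (S : Set (G n).V), ((G n).induce S).graph.Connected →
      ∃ i : ℕ+, Nonempty (((G n).induce S).Iso (G i)))
    (hbij : Function.Bijective (tildeLift (K := K) fun n => (G n).csf K)) :
    ∃ φ : Lambda K →ₐc[K] LambdaTilde K,
      ∀ n, φ ((G n).csf K) = toTilde K ((G n).compl.csf K) := by
  -- `θ` presents `Λ` as the polynomial ring on the `X_{G_n}`, so their images can be prescribed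
  -- freely.
  let θ := AlgEquiv.ofBijective _ hbij
  let φ : Lambda K →ₐ[K] LambdaTilde K :=
    (tildeLift (K := K) fun n => toTilde K ((G n).compl.csf K)).comp θ.symm.toAlgHom
  have hθ : ∀ n, θ (tBasis K {n}) = (G n).csf K := fun n => by
    change tildeLift (K := K) (fun n => (G n).csf K) (tBasis K {n}) = _
    rw [tildeLift_basis]; simp
  have hφ : ∀ n, φ ((G n).csf K) = toTilde K ((G n).compl.csf K) := fun n => by
    change tildeLift (K := K) (fun n => toTilde K ((G n).compl.csf K)) (θ.symm ((G n).csf K)) = _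
    rw [← hθ, AlgEquiv.symm_apply_apply, tildeLift_basis]; simp
  have hadj : Algebra.adjoin K (Set.range fun n => (G n).csf K) = ⊤ := by
    have h1 := congrArg (Subalgebra.map θ.toAlgHom) (tilde_adjoin (K := K))
    rw [AlgHom.map_adjoin, ← Set.range_comp, Algebra.map_top,
      (AlgHom.range_eq_top θ.toAlgHom).mpr θ.surjective] at h1
    rw [← h1]
    congr 2
    funext n
    exact (hθ n).symm
  -- Both counits vanish on the generators, whose degrees are positive.
  have hpos : ∀ n, ∀ f ∈ Lambda.homog K (n : ℕ+), counitLin K f = 0 := fun n f hf =>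
    hf 0 (by simpa using n.ne_zero.symm)
  refine ⟨BialgHom.ofAlgHom φ ?_ ?_, hφ⟩
  · refine AlgHom.ext_of_adjoin_eq_top hadj ?_
    rintro _ ⟨n, rfl⟩
    change counitTilde K (φ ((G n).csf K)) = counitLin K ((G n).csf K)
    rw [hφ, hpos n _ (hweight n ▸ csf_homog (G n))]
    exact hpos n _ (hweight n ▸ csf_homog (G n).compl)
  · refine AlgHom.ext_of_adjoin_eq_top hadj ?_
    rintro _ ⟨n, rfl⟩
    change Algebra.TensorProduct.map φ φ (coprod K ((G n).csf K)) =
      coprodTilde K (φ ((G n).csf K))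
    rw [hφ, coprodTilde, LinearMap.comp_apply, LinearMap.comp_apply]
    change _ = TensorProduct.map (toTilde K).toLinearMap (toTilde K).toLinearMap
      (coprod K ((toTilde K).symm (toTilde K ((G n).compl.csf K))))
    -- Both coproducts are now sums over the same vertex sets `S`, and they are compared term by
    -- term.
    rw [LinearEquiv.symm_apply_apply, coprod_csf, coprod_csf_compl, map_sum, map_sum]
    refine Finset.sum_congr rfl fun S _ => ?_
    rw [Algebra.TensorProduct.map_tmul, TensorProduct.map_tmul,
      map_csf_induce G hind φ hφ, map_csf_induce G hind φ hφ]
    rfl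

end

end WGraph

end SymF

/-! ### Uniqueness, degrees and cliques -/

theorem proposition1p5 {K : Type*} [Field K] [CharZero K] (G : ℕ+ → SymF.WGraph.{u})
    (hconn : ∀ n, (G n).graph.Connected)
    (hweight : ∀ n : ℕ+, (G n).totalWeight = (n : ℕ))
    (hind : ∀ (n : ℕ+) (S : Set (G n).V), ((G n).induce S).graph.Connected →
      ∃ i : ℕ+, Nonempty (((G n).induce S).Iso (G i))) :
    ∃ φ : SymF.Lambda K →ₐc[K] SymF.LambdaTilde K,
      (∀ l : Multiset ℕ+, φ ((SymF.WGraph.ofPartition G l).csf K) =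
        SymF.toTilde K ((SymF.WGraph.ofPartition G l).compl.csf K)) ∧
      (∀ ψ : SymF.Lambda K →ₗ[K] SymF.LambdaTilde K,
        (∀ l : Multiset ℕ+, ψ ((SymF.WGraph.ofPartition G l).csf K) =
          SymF.toTilde K ((SymF.WGraph.ofPartition G l).compl.csf K)) → ∀ f, ψ f = φ f) ∧
      (∀ n : ℕ, ∀ f ∈ SymF.Lambda.homog K n, φ f ∈ SymF.LambdaTilde.homog K n) ∧
      (Function.Bijective φ → ∀ n : ℕ+, (G n).graph = ⊤) := by
  open SymF SymF.WGraph in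
  choose a ha hlead using fun n => csf_leading (K := K) (G n) (hconn n) (hweight n)
  have hbij := tildeLift_bijective (fun n => (G n).csf K) a ha hlead
  obtain ⟨φ, hφ⟩ := exists_bialgHom G hweight hind hbij
  have hθ : ∀ l, tildeLift (K := K) (fun n => (G n).csf K) (tBasis K l) =
      (ofPartition G l).csf K := fun l => by rw [tildeLift_basis, csf_ofPartition]
  have hpart : ∀ l : Multiset ℕ+, φ ((ofPartition G l).csf K) =
      toTilde K ((ofPartition G l).compl.csf K) := fun l => by
    rw [csf_ofPartition, csf_compl_ofPartition, map_multiset_prod, Multiset.map_map]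
    simp only [Function.comp, hφ]
  -- The `X_{G_λ}` are the images of the basis `m̃_λ` under a linear bijection, so linear maps are
  -- determined by their values there.
  have hlin : ∀ {M : Type _} [AddCommGroup M] [Module K M] (f g : Lambda K →ₗ[K] M),
      (∀ l, f ((ofPartition G l).csf K) = g ((ofPartition G l).csf K)) → ∀ x, f x = g x := by
    intro M _ _ f g h x
    obtain ⟨x, rfl⟩ := hbij.2 x
    refine LinearMap.congr_fun (f := f ∘ₗ (tildeLift (K := K) fun n => (G n).csf K).toLinearMap)
      (g := g ∘ₗ (tildeLift (K := K) fun n => (G n).csf K).toLinearMap)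
      ((tBasis K).ext fun l => ?_) x
    change f (tildeLift (K := K) (fun n => (G n).csf K) (tBasis K l)) =
      g (tildeLift (K := K) (fun n => (G n).csf K) (tBasis K l))
    rw [hθ, h]
  have hdeg : ∀ n : ℕ, ∀ f ∈ Lambda.homog K n, φ f ∈ LambdaTilde.homog K n := by
    intro n f hf
    -- Modulo the degree `n` part of `Λ̃`, the map `φ` after the projection to degree `n` is to
    -- vanish. This can be tested on the `X_{G_λ}`, each homogeneous: the projection fixes it or
    -- kills it.
    rw [← homogProj_of_mem hf, ← Submodule.Quotient.mk_eq_zero]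
    refine hlin ((LambdaTilde.homog K n).mkQ ∘ₗ (φ : Lambda K →ₗ[K] LambdaTilde K) ∘ₗ
      homogProj K n) 0 (fun l => ?_) f
    change (LambdaTilde.homog K n).mkQ (φ (homogProj K n ((ofPartition G l).csf K))) = 0
    by_cases h : n = (ofPartition G l).totalWeight
    · subst h
      rw [homogProj_of_mem (csf_homog _), hpart, Submodule.mkQ_apply,
        Submodule.Quotient.mk_eq_zero]
      exact ⟨_, csf_homog (ofPartition G l).compl, rfl⟩
    · rw [homogProj_of_ne h (csf_homog _), map_zero, map_zero]
  refine ⟨φ, hpart, fun ψ hψ f => ?_, hdeg, fun hiso n => ?_⟩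
  · exact hlin ψ (φ : Lambda K →ₗ[K] LambdaTilde K) (fun l => (hψ l).trans (hpart l).symm) f
  · have hprim : ∀ k : ℕ+, ∃ c : K, φ (psum K k) = c • tBasis K {k} := by
      intro k
      obtain ⟨x, hx, hxk⟩ := hdeg k _ (psum_homog k)
      have hx' : toTilde K x = φ (psum K k) := hxk
      have hcomul : coprodTilde K (φ (psum K k)) =
          TensorProduct.map (φ : Lambda K →ₗ[K] LambdaTilde K) (φ : Lambda K →ₗ[K] LambdaTilde K)
            (coprod K (psum K k)) :=
        (CoalgHomClass.map_comp_comul_apply φ (psum K k)).symm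
      rw [coprod_psum, map_add, TensorProduct.map_tmul, TensorProduct.map_tmul] at hcomul
      -- `φ (psum K k)` is primitive since `p_k` is. The identity is carried back to `Λ`, which
      -- shares the coproduct and the unit with `Λ̃`, so that `eq_smul_of_primitive` applies.
      have h1 : coprod K x = x ⊗ₜ 1 + 1 ⊗ₜ x := by
        have h2 := congrArg (TensorProduct.map (toTilde K).symm.toLinearMap
          (toTilde K).symm.toLinearMap) hcomul
        rw [coprodTilde, LinearMap.comp_apply, LinearMap.comp_apply, ← hx'] at h2
        have hid : (toTilde K).symm.toLinearMap ∘ₗ (toTilde K).toLinearMap = LinearMap.id :=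
          LinearMap.ext fun y => (toTilde K).symm_apply_apply y
        rw [← LinearMap.comp_apply, ← TensorProduct.map_comp, hid, TensorProduct.map_id,
          LinearMap.id_apply, LinearEquiv.coe_coe, LinearEquiv.symm_apply_apply] at h2
        rw [h2, map_add, TensorProduct.map_tmul, TensorProduct.map_tmul]
        change (toTilde K).symm (φ (psum K k)) ⊗ₜ[K] (toTilde K).symm (φ 1) +
          (toTilde K).symm (φ 1) ⊗ₜ[K] (toTilde K).symm (φ (psum K k)) = _
        rw [map_one, symm_one_tilde, ← hx', LinearEquiv.symm_apply_apply]
      rw [← hx', eq_smul_of_primitive h1 hx, map_smul, ← tBasis_apply]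
      exact ⟨_, rfl⟩
    choose c hc using hprim
    have hcn : c n ≠ 0 := by
      intro h0
      have h1 := hc n
      rw [h0, zero_smul] at h1
      have h2 : psum K n = 0 := hiso.1 (h1.trans (map_zero φ).symm)
      exact (mBasis K).ne_zero _ h2
    -- Since `φ` maps each `p_k` to a multiple of `m̃_k`, polynomials in the lower `p_k` go to
    -- polynomials in the lower `m̃_k`.
    have hr : φ ((G n).csf K - a n • psum K n) ∈
        Algebra.adjoin K ((fun k : ℕ+ => tBasis K {k}) '' Set.Iio n) := by
      have h1 : Algebra.adjoin K (psum K '' Set.Iio n) ≤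
          (Algebra.adjoin K ((fun k : ℕ+ => tBasis K {k}) '' Set.Iio n)).comap
            (φ : Lambda K →ₐ[K] LambdaTilde K) := by
        rw [Algebra.adjoin_le_iff]
        rintro _ ⟨k, hk, rfl⟩
        change φ (psum K k) ∈ Algebra.adjoin K ((fun k : ℕ+ => tBasis K {k}) '' Set.Iio n)
        rw [hc]
        exact Subalgebra.smul_mem _ (Algebra.subset_adjoin
          (Set.mem_image_of_mem (fun k : ℕ+ => tBasis K {k}) hk)) _
      exact h1 (hlead n)
    -- Taking the coefficient of `x_0^n` gives `a n * c n` as the number of proper colorings of the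
    -- complement with monomial `x_0^n`. Such a coloring is constant, so its existence leaves the
    -- complement without edges.
    have h1 := co_adjoin_lt hr
    rw [map_sub, map_smul, hφ, hc, map_sub, LinearEquiv.symm_apply_apply, map_smul, map_smul,
      tBasis_apply, LinearEquiv.symm_apply_apply, map_sub, map_smul, map_smul, co_mtBasis,
      expType_single, if_pos rfl, multFact_singleton, sub_eq_zero, co_csf] at h1
    have h2 : Nat.card ((G n).compl.PropCol (Finsupp.single 0 (n : ℕ))) ≠ 0 := by
      intro h0
      rw [h0] at h1
      simp [ha n, hcn] at h1
    obtain ⟨⟨κ, hκ, hm⟩⟩ := (Nat.card_ne_zero.mp h2).1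
    have h3 : ∀ v : (G n).compl.V, κ v = 0 := fun v => by
      have := ((G n).compl.mem_support_colorMon κ (κ v)).mpr ⟨v, rfl⟩
      rw [hm] at this
      simpa using Finsupp.support_single_subset this
    ext x y
    rw [SimpleGraph.top_adj]
    refine ⟨fun h => h.ne, fun hne => ?_⟩
    by_contra hxy
    exact hκ x y ((SimpleGraph.compl_adj _ _ _).mpr ⟨hne, hxy⟩) ((h3 x).trans (h3 y).symm)
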